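/- Work in $\mathfrak H=L^2(\mathbb R,dx)$ with $(Q\varphi)(x)=x\varphi(x)$, $(P\varphi)(x)=-i\varphi'(x)$, $a=(Q+iP)/\sqrt2$, $a^\dagger=(Q-iP)/\sqrt2$, all acting on the Schwartz space $\mathcal S(\mathbb R)$. For $z=(q+ip)/\sqrt2\in\mathbb C$ let $D(z)=e^{za^\dagger-\bar z a}$ be the unitary displacement operator, $(D(z)\varphi)(x)=e^{ip(x-q/2)}\varphi(x-q)$. Let $\varpi:\mathbb C\to\mathbb C$ be a weight which is $C^2$ near $0$ and which defines a bounded operator $\mathsf M=\int_{\mathbb C}\varpi(z)D(z)\,\frac{d^2z}{\pi}$ weakly on $\mathcal S(\mathbb R)$: for all $\varphi,\psi\in\mathcal S(\mathbb R)$ the function $z\mapsto\varpi(z)\langle\varphi,D(z)\psi\rangle$ is integrable and $\langle\varphi,\mathsf M\psi\rangle=\int_{\mathbb C}\varpi(z)\langle\varphi,D(z)\psi\rangle\frac{d^2z}{\pi}$. Put $\mathsf M(z)=D(z)\mathsf MD(z)^\dagger$. For $f:\mathbb C\to\mathbb C$ and a linear operator $A$ on $\mathcal S(\mathbb R)$,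 write $$A_f=\int_{\mathbb C}f(z)\,\mathsf M(z)\,\frac{d^2z}{\pi}=A$$ if for all $\varphi,\psi\in\mathcal S(\mathbb R)$ one has $\langle\varphi,A\psi\rangle=\int_{\mathbb C}f(z)\langle\varphi,\mathsf M(z)\psi\rangle\frac{d^2z}{\pi}$ as an oscillatory integral, that is, for every Schwartz function $\chi$ on $\mathbb C$ with $\chi(0)=1$ and every $\varepsilon>0$ the function $z\mapsto\chi(\varepsilon z)f(z)\langle\varphi,\mathsf M(z)\psi\rangle$ is integrable, and $$\langle\varphi,A\psi\rangle=\lim_{\varepsilon\to0^+}\int_{\mathbb C}\chi(\varepsilon z)f(z)\langle\varphi,\mathsf M(z)\psi\rangle\frac{d^2z}{\pi}.$$ (This is the Lebesgue integral whenever the latter converges absolutely, and $f$ and $\mathsf M$ determine $A$.) Let $\partial_z,\partial_{\bar z}$ be the Wirtinger derivatives. 1. One has $$A_{|z|^2}=\varpi(0)\,a^\dagger a+\partial_z\varpi(0)\,a-\partial_{\bar z}\varpi(0)\,a^\dagger+\frac{\varpi(0)}2-\partial_z\partial_{\bar z}\varpi(0).$$ 2. Suppose that the weight is regular: $\varpi(0)=1$,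 $\varpi(-z)=\varpi(z)$ and $\overline{\varpi(z)}=\varpi(z)$ for all $z$. Then $$A_{|z|^2}=a^\dagger a+\tfrac12-\partial_z\partial_{\bar z}\varpi(0),$$ $$A_{q^2}=Q^2-\partial_z\partial_{\bar z}\varpi(0)+\tfrac12\left(\partial_z^2\varpi(0)+\partial_{\bar z}^2\varpi(0)\right),$$ $$A_{p^2}=P^2-\partial_z\partial_{\bar z}\varpi(0)-\tfrac12\left(\partial_z^2\varpi(0)+\partial_{\bar z}^2\varpi(0)\right).$$ For an operator $A$ on $\mathcal S(\mathbb R)$ with real expectation values, let $\min(A)$ be the infimum of $\langle\varphi,A\varphi\rangle$ over $\varphi\in\mathcal S(\mathbb R)$ with $\|\varphi\|=1$. The three operators have real expectation values and finite minima, the ground state energy $E_0=\min(A_{|z|^2})$ is an eigenvalue of $A_{|z|^2}$, and, with $E_m=[\min(A_{q^2})+\min(A_{p^2})]/2$, $$E_0=\tfrac12-\partial_z\partial_{\bar z}\varpi(0),\qquad E_m=-\partial_z\partial_{\bar z}\varpi(0),\qquad E_0-E_m=\tfrac12.$$ -/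

import Mathlib

open MeasureTheory Filter Topology SchwartzMap
open scoped ComplexConjugate ENNReal

noncomputable section

namespace IntegralQuantization

/-- The Hilbert space `L²(ℝ, dx)` of the Schrödinger representation. -/
abbrev Hilb : Type := Lp ℂ 2 (volume : Measure ℝ)

/-- The vector of `L²(ℝ, dx)` defined by a Schwartz function. -/
abbrev vec (φ : 𝓢(ℝ, ℂ)) : Hilb := φ.toLp 2 volume

/-! ### Classical phase space: `z = (q + i p) / √2` -/

/-- The position coordinate `q = √2 Re z`. -/
def qOf (z : ℂ) : ℝ := √2 * z.re

/-- The momentum coordinate `p = √2 Im z`. -/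
def pOf (z : ℂ) : ℝ := √2 * z.im

/-- The Wirtinger derivative `∂_z = (∂_x - i ∂_y) / 2`, where `z = x + i y`. -/
def dz (f : ℂ → ℂ) (w : ℂ) : ℂ :=
  (fderiv ℝ f w 1 - Complex.I * fderiv ℝ f w Complex.I) / 2

/-- The Wirtinger derivative `∂_{z̄} = (∂_x + i ∂_y) / 2`, where `z = x + i y`. -/
def dzbar (f : ℂ → ℂ) (w : ℂ) : ℂ :=
  (fderiv ℝ f w 1 + Complex.I * fderiv ℝ f w Complex.I) / 2

/-! ### Displacement operators -/

/-- `(U(q,p) φ)(x) = e^{i p (x - q/2)} φ(x - q)`, on functions. -/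
def displaceFun (z : ℂ) (φ : ℝ → ℂ) (x : ℝ) : ℂ :=
  Complex.exp (Complex.I * ((pOf z * (x - qOf z / 2) : ℝ) : ℂ)) * φ (x - qOf z)

theorem norm_displaceFun (z : ℂ) (φ : ℝ → ℂ) (x : ℝ) :
    ‖displaceFun z φ x‖ = ‖φ (x - qOf z)‖ := by
  rw [displaceFun, norm_mul, mul_comm Complex.I, Complex.norm_exp_ofReal_mul_I, one_mul]

theorem displaceFun_congr (z : ℂ) {φ ψ : ℝ → ℂ} (h : φ =ᵐ[volume] ψ) :
    displaceFun z φ =ᵐ[volume] displaceFun z ψ := by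
  have h' := (measurePreserving_sub_right (volume : Measure ℝ) (qOf z)).quasiMeasurePreserving.ae h
  filter_upwards [h'] with x hx
  simp only [displaceFun, hx]

theorem aestronglyMeasurable_displaceFun (z : ℂ) {φ : ℝ → ℂ}
    (h : AEStronglyMeasurable φ volume) : AEStronglyMeasurable (displaceFun z φ) volume := by
  have h1 : AEStronglyMeasurable (fun x => φ (x - qOf z)) volume :=
    h.comp_measurePreserving (measurePreserving_sub_right (volume : Measure ℝ) (qOf z))
  have h2 : Continuous fun x : ℝ =>
      Complex.exp (Complex.I * ((pOf z * (x - qOf z / 2) : ℝ) : ℂ)) := by fun_prop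
  exact h2.aestronglyMeasurable.mul h1

theorem eLpNorm_displaceFun (z : ℂ) {φ : ℝ → ℂ} (h : AEStronglyMeasurable φ volume) :
    eLpNorm (displaceFun z φ) 2 volume = eLpNorm φ 2 volume := by
  rw [eLpNorm_congr_norm_ae (g := φ ∘ fun x => x - qOf z)
    (Eventually.of_forall fun x => norm_displaceFun z φ x)]
  exact eLpNorm_comp_measurePreserving h
    (measurePreserving_sub_right (volume : Measure ℝ) (qOf z))

theorem memLp_displaceFun (z : ℂ) {φ : ℝ → ℂ} (h : MemLp φ 2 volume) :
    MemLp (displaceFun z φ) 2 volume :=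
  ⟨aestronglyMeasurable_displaceFun z h.1, by rw [eLpNorm_displaceFun z h.1]; exact h.2⟩

/-- The displacement operator `D(z) = U(q,p) = e^{z a† - z̄ a}` on `L²(ℝ, dx)`. -/
def displacement (z : ℂ) : Hilb →ₗᵢ[ℂ] Hilb where
  toFun φ := (memLp_displaceFun z (Lp.memLp φ)).toLp _
  map_add' φ ψ := by
    rw [← MemLp.toLp_add, MemLp.toLp_eq_toLp_iff]
    refine (displaceFun_congr z (Lp.coeFn_add φ ψ)).trans (Eventually.of_forall fun x => ?_)
    simp only [displaceFun, Pi.add_apply, mul_add]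
  map_smul' c φ := by
    rw [RingHom.id_apply, ← MemLp.toLp_const_smul, MemLp.toLp_eq_toLp_iff]
    refine (displaceFun_congr z (Lp.coeFn_smul c φ)).trans (Eventually.of_forall fun x => ?_)
    simp only [displaceFun, Pi.smul_apply, smul_eq_mul]
    ring
  norm_map' φ := by
    change ‖(memLp_displaceFun z (Lp.memLp φ)).toLp _‖ = ‖φ‖
    rw [Lp.norm_toLp, eLpNorm_displaceFun z (Lp.aestronglyMeasurable φ), Lp.norm_def]

/-- `D(z)` as a bounded operator. -/
def D (z : ℂ) : Hilb →L[ℂ] Hilb := (displacement z).toContinuousLinearMap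

theorem coeFn_D (z : ℂ) (φ : Hilb) : D z φ =ᵐ[volume] displaceFun z φ :=
  (memLp_displaceFun z (Lp.memLp φ)).coeFn_toLp

/-! ### Position, momentum and ladder operators, on the Schwartz domain -/

/-- `(Q φ)(x) = x φ(x)`. -/
def opQ : Module.End ℂ 𝓢(ℝ, ℂ) := (smulLeftCLM ℂ (fun x : ℝ => (x : ℂ))).toLinearMap

/-- `(P φ)(x) = -i φ'(x)`. -/
def opP : Module.End ℂ 𝓢(ℝ, ℂ) := -Complex.I • (derivCLM ℂ ℂ).toLinearMap

theorem opQ_apply (φ : 𝓢(ℝ, ℂ)) (x : ℝ) : opQ φ x = x * φ x := by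
  have h : (fun x : ℝ => (x : ℂ)).HasTemperateGrowth :=
    Complex.ofRealCLM.hasTemperateGrowth
  simp [opQ, smulLeftCLM_apply_apply h]

theorem opP_apply (φ : 𝓢(ℝ, ℂ)) (x : ℝ) : opP φ x = -Complex.I * deriv φ x := by
  simp [opP, derivCLM_apply]

/-- The lowering operator `a = (Q + i P) / √2`. -/
def opA : Module.End ℂ 𝓢(ℝ, ℂ) := ((√2 : ℝ) : ℂ)⁻¹ • (opQ + Complex.I • opP)

/-- The raising operator `a† = (Q - i P) / √2`. -/
def opAdag : Module.End ℂ 𝓢(ℝ, ℂ) := ((√2 : ℝ) : ℂ)⁻¹ • (opQ - Complex.I • opP)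

/-! ### Oscillatory integrals over the complex plane -/

/-- `L` is the value of `∫ F(z) d²z` as an oscillatory integral: for every Schwartz cut-off `χ`
with `χ(0) = 1`, the functions `χ(ε z) F(z)` are integrable and their integrals tend to `L`
as `ε → 0⁺`. -/
def HasOscIntegral (F : ℂ → ℂ) (L : ℂ) : Prop :=
  ∀ χ : 𝓢(ℂ, ℂ), χ 0 = 1 →
    (∀ ε : ℝ, 0 < ε → Integrable (fun z : ℂ => χ (ε • z) * F z)) ∧
    Tendsto (fun ε : ℝ => ∫ z : ℂ, χ (ε • z) * F z) (𝓝[>] 0) (𝓝 L)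

/-- For an integrable function the oscillatory integral is the Lebesgue integral. -/
theorem hasOscIntegral_integral {F : ℂ → ℂ} (hF : Integrable F) :
    HasOscIntegral F (∫ z, F z) := by
  intro χ hχ
  obtain ⟨C, hC⟩ : ∃ C : ℝ, ∀ x, ‖χ x‖ ≤ C := by
    obtain ⟨C, -, hC⟩ := χ.decay 0 0
    exact ⟨C, fun x => by simpa using hC x⟩
  have hm (ε : ℝ) : AEStronglyMeasurable (fun z : ℂ => χ (ε • z) * F z) volume :=
    (χ.continuous.comp (continuous_const_smul ε)).aestronglyMeasurable.mul hF.1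
  have hb (ε : ℝ) (z : ℂ) : ‖χ (ε • z) * F z‖ ≤ C * ‖F z‖ := by
    rw [norm_mul]
    exact mul_le_mul_of_nonneg_right (hC _) (norm_nonneg _)
  refine ⟨fun ε _ => (hF.norm.const_mul C).mono' (hm ε) (Eventually.of_forall (hb ε)), ?_⟩
  refine tendsto_integral_filter_of_dominated_convergence (fun z => C * ‖F z‖)
    (Eventually.of_forall hm) (Eventually.of_forall fun ε => Eventually.of_forall (hb ε))
    (hF.norm.const_mul C) (Eventually.of_forall fun z => ?_)
  have h : Continuous fun ε : ℝ => χ (ε • z) * F z := by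
    have := χ.continuous
    fun_prop
  have h0 := (h.tendsto 0).mono_left (nhdsWithin_le_nhds (s := Set.Ioi 0))
  simpa [hχ] using h0

/-- The value of an oscillatory integral is unique. -/
theorem HasOscIntegral.unique {F : ℂ → ℂ} {L L' : ℂ} (h : HasOscIntegral F L)
    (h' : HasOscIntegral F L') : L = L' := by
  let b : ContDiffBump (0 : ℂ) := ⟨1, 2, one_pos, one_lt_two⟩
  have hs : HasCompactSupport fun z : ℂ => ((b z : ℝ) : ℂ) :=
    b.hasCompactSupport.comp_left (g := fun r : ℝ => (r : ℂ)) Complex.ofReal_zero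
  have hd : ContDiff ℝ (⊤ : ℕ∞) fun z : ℂ => ((b z : ℝ) : ℂ) :=
    Complex.ofRealCLM.contDiff.comp b.contDiff
  have h1 : (hs.toSchwartzMap hd) 0 = 1 := by
    change ((b 0 : ℝ) : ℂ) = 1
    rw [b.one_of_mem_closedBall (Metric.mem_closedBall_self b.rIn_pos.le)]
    simp
  exact tendsto_nhds_unique (h _ h1).2 (h' _ h1).2

/-! ### Weights and the quantization map -/

/-- The weight `ϖ` defines the bounded operator `M = ∫ ϖ(z) D(z) d²z/π`, in the weak sense on the
dense domain of Schwartz functions. -/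
def IsWeightOperator (ϖ : ℂ → ℂ) (M : Hilb →L[ℂ] Hilb) : Prop :=
  ∀ φ ψ : 𝓢(ℝ, ℂ),
    Integrable (fun z : ℂ => ϖ z * inner ℂ (vec φ) (D z (vec ψ)) / Real.pi) ∧
    inner ℂ (vec φ) (M (vec ψ)) =
      ∫ z : ℂ, ϖ z * inner ℂ (vec φ) (D z (vec ψ)) / Real.pi

/-- The displaced operator `M(z) = D(z) M D(z)†`. -/
def displaced (M : Hilb →L[ℂ] Hilb) (z : ℂ) : Hilb →L[ℂ] Hilb :=
  D z ∘L M ∘L ContinuousLinearMap.adjoint (D z)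

/-- `A = A_f = ∫ f(z) M(z) d²z/π`, as a sesquilinear form on the Schwartz domain, the integrals
being oscillatory integrals. -/
def IsQuantization (M : Hilb →L[ℂ] Hilb) (f : ℂ → ℂ) (A : Module.End ℂ 𝓢(ℝ, ℂ)) : Prop :=
  ∀ φ ψ : 𝓢(ℝ, ℂ),
    HasOscIntegral (fun z : ℂ => f z * inner ℂ (vec φ) (displaced M z (vec ψ)) / Real.pi)
      (inner ℂ (vec φ) (vec (A ψ)))

/-- When the defining integral converges absolutely, `A_f` is given by that integral. -/
theorem IsQuantization.inner_eq_integral {M : Hilb →L[ℂ] Hilb} {f : ℂ → ℂ}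
    {A : Module.End ℂ 𝓢(ℝ, ℂ)} (h : IsQuantization M f A) (φ ψ : 𝓢(ℝ, ℂ))
    (hi : Integrable fun z : ℂ =>
      f z * inner ℂ (vec φ) (displaced M z (vec ψ)) / Real.pi) :
    inner ℂ (vec φ) (vec (A ψ)) =
      ∫ z : ℂ, f z * inner ℂ (vec φ) (displaced M z (vec ψ)) / Real.pi :=
  (h φ ψ).unique (hasOscIntegral_integral hi)

/-- Regular weights: normalised, even and real-valued. -/
structure IsRegularWeight (ϖ : ℂ → ℂ) : Prop where
  map_zero : ϖ 0 = 1
  even : ∀ z, ϖ (-z) = ϖ z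
  real : ∀ z, conj (ϖ z) = ϖ z

/-! ### Energies -/

/-- The expectation value `⟨φ, A φ⟩`. -/
def expect (A : Module.End ℂ 𝓢(ℝ, ℂ)) (φ : 𝓢(ℝ, ℂ)) : ℂ := inner ℂ (vec φ) (vec (A φ))

/-- `m` is the minimum `min A` of the operator `A`, i.e. the bottom of `A`: the expectation values
in normalised states are real and `m` is their infimum. -/
def IsMinOf (A : Module.End ℂ 𝓢(ℝ, ℂ)) (m : ℝ) : Prop :=
  (∀ φ, (expect A φ).im = 0) ∧
    IsGLB {r : ℝ | ∃ φ : 𝓢(ℝ, ℂ), ‖vec φ‖ = 1 ∧ (expect A φ).re = r} m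

/-- `E` is the ground state energy of `A`: it is the minimum of `A`, and it is an eigenvalue. -/
def IsGroundStateEnergy (A : Module.End ℂ 𝓢(ℝ, ℂ)) (E : ℝ) : Prop :=
  IsMinOf A E ∧ A.HasEigenvalue (E : ℂ)

end IntegralQuantization

end

open IntegralQuantization

/-!
Conjugating a displacement operator by another one only produces a phase,
`D(z) D(w) D(z)† = e^{2i Im(z w̄)} D(w)`, so `z ↦ ⟨φ, M(z) ψ⟩` is, up to a quarter turn and a
scaling by `π`, the Fourier transform of `h(w) = ϖ(w) ⟨φ, D(w) ψ⟩ / π`. A quadratic moment in `z`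
is therefore a second derivative of `h` at `0`, and as `D(w)` is generated by `w a† - w̄ a`, the
product rule produces the operators.

The weight is only smooth near `0`, so Fourier inversion does not apply to `h` itself. It applies to
a Schwartz function with the same second-order Taylor polynomial at `0`. The remainder is `o(|w|²)`
and does not contribute: moved onto the cutoff `χ(ε z)`, the Fourier transform yields a family of
kernels concentrating at `0` whose integrals against `|w|²` stay bounded.

The operators of the regular case are of the form `B† B + m`. Their minimum is `m`: for `B = a`
because `a` kills the Gaussian, for `B = Q, P` because dilations make `B` arbitrarily small.
-/

noncomputable section

namespace IntegralQuantization

open Asymptotics FourierTransform LineDeriv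

section SecondOrderCalculus

variable {E F : Type*} [NormedAddCommGroup E] [NormedSpace ℝ E] [NormedAddCommGroup F]
  [NormedSpace ℝ F] {f : E → F} {x₀ : E}

theorem differentiableAt_fderiv_of_contDiffAt_two (hf : ContDiffAt ℝ 2 f x₀) :
    DifferentiableAt ℝ (fderiv ℝ f) x₀ :=
  (hf.fderiv_right (m := 1) (by norm_num)).differentiableAt one_ne_zero

theorem eventually_differentiableAt_of_contDiffAt_two (hf : ContDiffAt ℝ 2 f x₀) :
    ∀ᶠ x in 𝓝 x₀, DifferentiableAt ℝ f x :=
  (hf.eventually (by simp)).mono fun _ hx => hx.differentiableAt two_ne_zero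

theorem hasFDerivAt_fderiv_apply (hf : ContDiffAt ℝ 2 f x₀) (u : E) :
    HasFDerivAt (fun x => fderiv ℝ f x u) ((fderiv ℝ (fderiv ℝ f) x₀).flip u) x₀ := by
  simpa using (differentiableAt_fderiv_of_contDiffAt_two hf).hasFDerivAt.clm_apply
    (hasFDerivAt_const u x₀)

theorem fderiv_fderiv_apply (hf : ContDiffAt ℝ 2 f x₀) (u v : E) :
    fderiv ℝ (fun x => fderiv ℝ f x u) x₀ v = fderiv ℝ (fderiv ℝ f) x₀ v u := by
  rw [(hasFDerivAt_fderiv_apply hf u).fderiv, ContinuousLinearMap.flip_apply]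

theorem fderiv_fderiv_mul_apply {A : Type*} [NormedCommRing A] [NormedAlgebra ℝ A] {f g : E → A}
    (hf : ContDiffAt ℝ 2 f x₀) (hg : ContDiffAt ℝ 2 g x₀) (u : E) :
    fderiv ℝ (fderiv ℝ fun x => f x * g x) x₀ u u =
      fderiv ℝ (fderiv ℝ f) x₀ u u * g x₀ + 2 * (fderiv ℝ f x₀ u * fderiv ℝ g x₀ u) +
        f x₀ * fderiv ℝ (fderiv ℝ g) x₀ u u := by
  have leibniz : (fun x => fderiv ℝ (fun y => f y * g y) x u) =ᶠ[𝓝 x₀]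
      fun x => f x * fderiv ℝ g x u + fderiv ℝ f x u * g x := by
    filter_upwards [eventually_differentiableAt_of_contDiffAt_two hf,
      eventually_differentiableAt_of_contDiffAt_two hg] with x hfx hgx
    simp [fderiv_fun_mul hfx hgx, mul_comm]
  have hf' := (hf.differentiableAt two_ne_zero).hasFDerivAt
  have hg' := (hg.differentiableAt two_ne_zero).hasFDerivAt
  rw [← fderiv_fderiv_apply (hf.mul hg), leibniz.fderiv_eq,
    ((hf'.fun_mul (hasFDerivAt_fderiv_apply hg u)).fun_add
      ((hasFDerivAt_fderiv_apply hf u).fun_mul hg')).fderiv]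
  simp only [add_apply, smul_apply, smul_eq_mul, ContinuousLinearMap.flip_apply]
  ring

/-- The second order Taylor polynomial of `f` at `x₀`. -/
def taylorQuad (f : E → F) (x₀ x : E) : F :=
  f x₀ + fderiv ℝ f x₀ (x - x₀) + (2⁻¹ : ℝ) • fderiv ℝ (fderiv ℝ f) x₀ (x - x₀) (x - x₀)

theorem contDiff_taylorQuad (f : E → F) (x₀ : E) {n : WithTop ℕ∞} :
    ContDiff ℝ n (taylorQuad f x₀) := by
  unfold taylorQuad
  fun_prop

theorem hasFDerivAt_taylorQuad (hf : ContDiffAt ℝ 2 f x₀) (x : E) :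
    HasFDerivAt (taylorQuad f x₀) (fderiv ℝ f x₀ + fderiv ℝ (fderiv ℝ f) x₀ (x - x₀)) x := by
  have hsymm : IsSymmSndFDerivAt ℝ f x₀ := hf.isSymmSndFDerivAt (by simp)
  have hid : HasFDerivAt (fun y : E => y - x₀) (ContinuousLinearMap.id ℝ E) x :=
    (hasFDerivAt_id x).sub_const x₀
  have h := ((hasFDerivAt_const (f x₀) x).add ((fderiv ℝ f x₀).hasFDerivAt.comp x hid)).add
    ((((fderiv ℝ (fderiv ℝ f) x₀).hasFDerivAt.comp x hid).clm_apply hid).const_smul (2⁻¹ : ℝ))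
  refine h.congr_fderiv ?_
  ext v
  simp [-map_sub, hsymm.eq v (x - x₀), ← two_smul ℝ]

theorem fderiv_fderiv_taylorQuad (hf : ContDiffAt ℝ 2 f x₀) (x : E) :
    fderiv ℝ (fderiv ℝ (taylorQuad f x₀)) x = fderiv ℝ (fderiv ℝ f) x₀ := by
  rw [show fderiv ℝ (taylorQuad f x₀) = _ from
    funext fun y => (hasFDerivAt_taylorQuad hf y).fderiv]
  exact (((fderiv ℝ (fderiv ℝ f) x₀).hasFDerivAt.comp x
    ((hasFDerivAt_id x).sub_const x₀)).const_add _).fderiv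

theorem isLittleO_sub_taylorQuad (hf : ContDiffAt ℝ 2 f x₀) :
    (fun x => f x - taylorQuad f x₀ x) =o[𝓝 x₀] fun x => ‖x - x₀‖ ^ 2 := by
  obtain ⟨r, hr, hdiff⟩ :=
    Metric.eventually_nhds_iff_ball.1 (eventually_differentiableAt_of_contDiffAt_two hf)
  have hderiv : ∀ x ∈ Metric.ball x₀ r, HasFDerivWithinAt (fun x => f x - taylorQuad f x₀ x)
      (fderiv ℝ f x - (fderiv ℝ f x₀ + fderiv ℝ (fderiv ℝ f) x₀ (x - x₀))) (Metric.ball x₀ r) x :=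
    fun x hx => ((hdiff x hx).hasFDerivAt.sub (hasFDerivAt_taylorQuad hf x)).hasFDerivWithinAt
  have hsmall : (fun x => fderiv ℝ f x - (fderiv ℝ f x₀ + fderiv ℝ (fderiv ℝ f) x₀ (x - x₀)))
      =o[𝓝 x₀] fun x => ‖x - x₀‖ ^ 1 := by
    simpa [sub_add_eq_sub_sub] using
      (differentiableAt_fderiv_of_contDiffAt_two hf).hasFDerivAt.isLittleO.norm_right
  simpa [taylorQuad, nhdsWithin_eq_nhds.2 (Metric.ball_mem_nhds x₀ hr)] using
    (convex_ball x₀ r).isLittleO_pow_succ (Metric.mem_ball_self hr) hderiv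
      (hsmall.mono nhdsWithin_le_nhds)

theorem exists_schwartzMap_eventuallyEq [FiniteDimensional ℝ E] (hf : ContDiff ℝ (⊤ : ℕ∞) f)
    (x₀ : E) : ∃ g : 𝓢(E, F), g =ᶠ[𝓝 x₀] f := by
  let b : ContDiffBump x₀ := ⟨1, 2, one_pos, one_lt_two⟩
  have hsupp : HasCompactSupport fun x => b x • f x := b.hasCompactSupport.smul_right
  refine ⟨hsupp.toSchwartzMap (b.contDiff.smul hf), ?_⟩
  filter_upwards [b.eventuallyEq_one] with x hx
  change b x • f x = f x
  rw [hx, Pi.one_apply, one_smul]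

theorem exists_schwartzMap_sub_isLittleO [FiniteDimensional ℝ E] (hf : ContDiffAt ℝ 2 f x₀) :
    ∃ g : 𝓢(E, F), (fun x => f x - g x) =o[𝓝 x₀] (fun x => ‖x - x₀‖ ^ 2) ∧
      fderiv ℝ (fderiv ℝ g) x₀ = fderiv ℝ (fderiv ℝ f) x₀ := by
  obtain ⟨g, hg⟩ := exists_schwartzMap_eventuallyEq (contDiff_taylorQuad f x₀) x₀
  refine ⟨g, (isLittleO_sub_taylorQuad hf).congr' (hg.mono fun x hx => ?_) .rfl, ?_⟩
  · simp only [hx]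
  · rw [hg.fderiv.fderiv_eq, fderiv_fderiv_taylorQuad hf]

theorem lineDeriv_lineDeriv_apply (f : 𝓢(E, F)) (u v x : E) :
    ∂_{v} (∂_{u} f) x = fderiv ℝ (fderiv ℝ f) x v u := by
  rw [lineDerivOp_apply_eq_fderiv, ← fderiv_fderiv_apply (f.smooth 2).contDiffAt,
    show ((∂_{u} f : 𝓢(E, F)) : E → F) = fun x => fderiv ℝ f x u from
      funext fun x => lineDerivOp_apply_eq_fderiv u f x]

end SecondOrderCalculus

section Concentration

variable {V G : Type*} [NormedAddCommGroup V] [NormedSpace ℝ V] [NormedAddCommGroup G]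
  [NormedSpace ℂ G]

theorem norm_schwartzMap_inv_smul_le (k : 𝓢(V, ℂ)) (m : ℕ) {δ ε : ℝ} (hδ : 0 < δ) (hε : 0 < ε)
    {w : V} (hw : δ ≤ ‖w‖) :
    ‖k (ε⁻¹ • w)‖ ≤ SchwartzMap.seminorm ℝ m 0 k / δ ^ m * ε ^ m := by
  have h := k.norm_pow_mul_le_seminorm ℝ m (ε⁻¹ • w)
  rw [norm_smul, Real.norm_of_nonneg (by positivity), mul_pow] at h
  have hδw : δ ^ m * ‖k (ε⁻¹ • w)‖ ≤ SchwartzMap.seminorm ℝ m 0 k * ε ^ m := calc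
    δ ^ m * ‖k (ε⁻¹ • w)‖ ≤ ‖w‖ ^ m * ‖k (ε⁻¹ • w)‖ := by gcongr
    _ = ε⁻¹ ^ m * ‖w‖ ^ m * ‖k (ε⁻¹ • w)‖ * ε ^ m := by
        rw [inv_pow]
        field_simp
    _ ≤ SchwartzMap.seminorm ℝ m 0 k * ε ^ m := by gcongr
  rw [div_mul_eq_mul_div, le_div_iff₀ (by positivity)]
  linarith

variable [MeasurableSpace V] {μ : Measure V} {R : V → G} {n : ℕ}

theorem tendsto_integral_schwartzMap_inv_smul_smul_of_eq_zero (k : 𝓢(V, ℂ)) (hR : Integrable R μ)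
    {δ : ℝ} (hδ : 0 < δ) (h0 : ∀ w ∈ Metric.ball 0 δ, R w = 0) :
    Tendsto (fun ε : ℝ => (ε ^ n)⁻¹ • ∫ w, k (ε⁻¹ • w) • R w ∂μ) (𝓝[>] 0) (𝓝 0) := by
  set C := SchwartzMap.seminorm ℝ (n + 1) 0 k / δ ^ (n + 1)
  have hbound : ∀ ε : ℝ, 0 < ε →
      ‖(ε ^ n)⁻¹ • ∫ w, k (ε⁻¹ • w) • R w ∂μ‖ ≤ (C * ∫ w, ‖R w‖ ∂μ) * ε := by
    intro ε hε
    have hpoint (w : V) : ‖k (ε⁻¹ • w) • R w‖ ≤ C * ε ^ (n + 1) * ‖R w‖ := by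
      by_cases hw : w ∈ Metric.ball 0 δ
      · simp [h0 w hw]
      · rw [norm_smul]
        gcongr
        exact norm_schwartzMap_inv_smul_le k (n + 1) hδ hε (by simpa using hw)
    have hint := norm_integral_le_of_norm_le (hR.norm.const_mul _) (Eventually.of_forall hpoint)
    rw [integral_const_mul] at hint
    calc ‖(ε ^ n)⁻¹ • ∫ w, k (ε⁻¹ • w) • R w ∂μ‖
        = (ε ^ n)⁻¹ * ‖∫ w, k (ε⁻¹ • w) • R w ∂μ‖ := by
          rw [norm_smul, Real.norm_of_nonneg (by positivity)]
      _ ≤ (ε ^ n)⁻¹ * (C * ε ^ (n + 1) * ∫ w, ‖R w‖ ∂μ) := by gcongr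
      _ = (C * ∫ w, ‖R w‖ ∂μ) * ε := by
          rw [pow_succ]
          field_simp
  have hlim : Tendsto (fun ε : ℝ => (C * ∫ w, ‖R w‖ ∂μ) * ε) (𝓝[>] 0) (𝓝 0) := by
    simpa using (tendsto_id.const_mul (C * ∫ w, ‖R w‖ ∂μ)).mono_left
      (nhdsWithin_le_nhds (a := (0 : ℝ)) (s := Set.Ioi 0))
  exact squeeze_zero_norm' (eventually_mem_nhdsWithin.mono hbound) hlim

variable [BorelSpace V]

theorem integrable_schwartzMap_inv_smul_smul (k : 𝓢(V, ℂ)) (hR : Integrable R μ) (ε : ℝ) :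
    Integrable (fun w => k (ε⁻¹ • w) • R w) μ :=
  hR.bdd_smul (SchwartzMap.seminorm ℝ 0 0 k)
    (k.continuous.comp (continuous_const_smul ε⁻¹)).aestronglyMeasurable
    (Eventually.of_forall fun _ => k.norm_le_seminorm ℝ _)

variable [FiniteDimensional ℝ V] [μ.IsAddHaarMeasure]

theorem integral_comp_inv_smul_smul (k : V → ℂ) (R : V → G) {ε : ℝ} (hε : 0 < ε) :
    ∫ w, k (ε⁻¹ • w) • R w ∂μ = ε ^ Module.finrank ℝ V • ∫ w, k w • R (ε • w) ∂μ := by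
  simpa only [smul_inv_smul₀ hε.ne'] using
    Measure.integral_comp_inv_smul_of_nonneg μ (fun w => k w • R (ε • w)) hε.le

theorem tendsto_integral_schwartzMap_smul_comp_smul (k : 𝓢(V, ℂ)) (hR : Integrable R μ)
    (ho : R =o[𝓝 0] fun w => ‖w‖ ^ n) (hb : ∀ w, ‖R w‖ ≤ ‖w‖ ^ n) :
    Tendsto (fun ε : ℝ => (ε ^ n)⁻¹ • ∫ w, k w • R (ε • w) ∂μ) (𝓝[>] 0) (𝓝 0) := by
  have hpoint (w : V) : Tendsto (fun ε : ℝ => (ε ^ n)⁻¹ • k w • R (ε • w)) (𝓝[>] 0) (𝓝 0) := by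
    have hw : Tendsto (fun ε : ℝ => ε • w) (𝓝[>] 0) (𝓝 0) := by
      simpa using ((tendsto_id (α := ℝ) (x := 𝓝 0)).smul_const w).mono_left nhdsWithin_le_nhds
    have hO : (fun ε : ℝ => ‖ε • w‖ ^ n) =O[𝓝[>] 0] fun ε => ε ^ n :=
      .of_bound (‖w‖ ^ n) (Eventually.of_forall fun ε => by
        simp [norm_smul, mul_pow, mul_comm])
    have := (((ho.comp_tendsto hw).trans_isBigO hO).tendsto_inv_smul_nhds_zero).const_smul (k w)
    simpa only [smul_comm (k w), smul_zero, Function.comp_apply] using this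
  have hbound : ∀ ε : ℝ, 0 < ε → ∀ w, ‖(ε ^ n)⁻¹ • k w • R (ε • w)‖ ≤ ‖w‖ ^ n * ‖k w‖ := by
    intro ε hε w
    calc ‖(ε ^ n)⁻¹ • k w • R (ε • w)‖ = (ε ^ n)⁻¹ * (‖k w‖ * ‖R (ε • w)‖) := by
          rw [norm_smul, norm_smul, Real.norm_of_nonneg (by positivity)]
      _ ≤ (ε ^ n)⁻¹ * (‖k w‖ * ‖ε • w‖ ^ n) := by gcongr; exact hb _
      _ = ‖w‖ ^ n * ‖k w‖ := by
          rw [norm_smul, Real.norm_of_nonneg hε.le, mul_pow]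
          field_simp
  simp only [← integral_smul]
  rw [← integral_zero V G (μ := μ)]
  refine tendsto_integral_filter_of_dominated_convergence (fun w => ‖w‖ ^ n * ‖k w‖) ?_ ?_
    (k.integrable_pow_mul μ n) (Eventually.of_forall hpoint)
  · filter_upwards [self_mem_nhdsWithin] with ε hε
    exact (k.continuous.aestronglyMeasurable.smul
      (hR.comp_smul (ne_of_gt hε)).aestronglyMeasurable).const_smul _
  · filter_upwards [self_mem_nhdsWithin] with ε hε using Eventually.of_forall (hbound ε hε)

theorem tendsto_integral_schwartzMap_inv_smul_smul (k : 𝓢(V, ℂ)) (hR : Integrable R μ)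
    (ho : R =o[𝓝 0] fun w => ‖w‖ ^ n) :
    Tendsto (fun ε : ℝ => (ε ^ (Module.finrank ℝ V + n))⁻¹ • ∫ w, k (ε⁻¹ • w) • R w ∂μ)
      (𝓝[>] 0) (𝓝 0) := by
  obtain ⟨δ, hδ, hball⟩ := Metric.eventually_nhds_iff_ball.1 (ho.def one_pos)
  set B := Metric.ball (0 : V) δ
  have hnear : Integrable (B.indicator R) μ := hR.indicator measurableSet_ball
  have hfar : Integrable (Bᶜ.indicator R) μ := hR.indicator measurableSet_ball.compl
  have hsplit (ε : ℝ) (hε : 0 < ε) : (ε ^ (Module.finrank ℝ V + n))⁻¹ • ∫ w, k (ε⁻¹ • w) • R w ∂μ =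
      (ε ^ n)⁻¹ • ∫ w, k w • B.indicator R (ε • w) ∂μ +
        (ε ^ (Module.finrank ℝ V + n))⁻¹ • ∫ w, k (ε⁻¹ • w) • Bᶜ.indicator R w ∂μ := by
    have hsum : ∫ w, k (ε⁻¹ • w) • R w ∂μ = ε ^ Module.finrank ℝ V •
        ∫ w, k w • B.indicator R (ε • w) ∂μ + ∫ w, k (ε⁻¹ • w) • Bᶜ.indicator R w ∂μ := by
      rw [← integral_comp_inv_smul_smul k (B.indicator R) hε,
        ← integral_add (integrable_schwartzMap_inv_smul_smul k hnear ε)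
          (integrable_schwartzMap_inv_smul_smul k hfar ε)]
      simp only [← smul_add, ← Pi.add_apply (B.indicator R), Set.indicator_self_add_compl]
    rw [hsum, smul_add, smul_smul, pow_add]
    congr 2
    field_simp
  have hnear_bound (w : V) : ‖B.indicator R w‖ ≤ ‖w‖ ^ n := by
    by_cases hw : w ∈ B
    · simpa [hw] using hball w hw
    · simp [hw]
  have hnear_o : B.indicator R =o[𝓝 0] fun w => ‖w‖ ^ n :=
    ho.congr' (mem_of_superset (Metric.ball_mem_nhds 0 hδ) fun w hw => by simp_all [B]) .rfl
  have hlim := (tendsto_integral_schwartzMap_smul_comp_smul k hnear hnear_o hnear_bound).add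
    (tendsto_integral_schwartzMap_inv_smul_smul_of_eq_zero (n := Module.finrank ℝ V + n) k hfar hδ
      fun w hw => by simp [B, hw])
  rw [add_zero] at hlim
  exact hlim.congr' (eventually_mem_nhdsWithin.mono fun ε hε => (hsplit ε hε).symm)

end Concentration

section Dilation

variable {E F : Type*} [NormedAddCommGroup E] [NormedSpace ℝ E] [NormedAddCommGroup F]
  [NormedSpace ℂ F]

/-- The dilation `x ↦ f (c x)` of a Schwartz function. -/
def dilation (c : ℝ) (hc : c ≠ 0) (f : 𝓢(E, F)) : 𝓢(E, F) :=
  compCLMOfContinuousLinearEquiv ℂ (ContinuousLinearEquiv.smulLeft (Units.mk0 c hc)) f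

theorem dilation_apply (c : ℝ) (hc : c ≠ 0) (f : 𝓢(E, F)) (x : E) :
    dilation c hc f x = f (c • x) := rfl

end Dilation

section FourierTransform

variable {V : Type*} [NormedAddCommGroup V] [InnerProductSpace ℝ V] [FiniteDimensional ℝ V]
  [MeasurableSpace V] [BorelSpace V]

theorem fourier_dilation {c : ℝ} (hc : 0 < c) (f : 𝓢(V, ℂ)) (w : V) :
    𝓕 (dilation c hc.ne' f) w = (c ^ Module.finrank ℝ V)⁻¹ • 𝓕 f (c⁻¹ • w) := by
  have h := Measure.integral_comp_smul_of_nonneg volume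
    (fun v : V => Real.fourierChar (-inner ℝ v (c⁻¹ • w)) • f v) c (hR := hc.le)
  simp only [fourier_coe, Real.fourier_eq, dilation_apply]
  rw [← h]
  simp only [real_inner_smul_left, real_inner_smul_right, inv_mul_cancel_left₀ hc.ne']

theorem integral_schwartz_mul_fourier (κ : 𝓢(V, ℂ)) {f : V → ℂ} (hf : Integrable f) :
    ∫ z, κ z * 𝓕 f z = ∫ w, 𝓕 κ w * f w := by
  simpa [fourier_coe] using! (VectorFourier.integral_bilin_fourierIntegral_eq_flip
    (.mul ℂ ℂ) (L := innerₗ V) Real.continuous_fourierChar continuous_inner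
    κ.integrable hf).symm

theorem integrable_schwartz_mul_fourier (κ : 𝓢(V, ℂ)) {f : V → ℂ} (hf : Integrable f) :
    Integrable fun z => κ z * 𝓕 f z :=
  κ.integrable.mul_bdd (c := ∫ v, ‖f v‖)
    (VectorFourier.fourierIntegral_continuous Real.continuous_fourierChar continuous_inner
      hf).aestronglyMeasurable
    (Eventually.of_forall fun _ => VectorFourier.norm_fourierIntegral_le_integral_norm _ _ _ _ _)

theorem integral_fourier (f : 𝓢(V, ℂ)) : ∫ z, 𝓕 f z = f 0 := by
  have h : 𝓕⁻ (𝓕 f) (0 : V) = f 0 := by rw [FourierTransform.fourierInv_fourier_eq]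
  simpa only [fourierInv_coe, Real.fourierInv_eq, inner_zero_right, AddChar.map_zero_eq_one,
    one_smul] using h

theorem fourier_lineDeriv_lineDeriv (f : 𝓢(V, ℂ)) (u z : V) :
    𝓕 (∂_{u} (∂_{u} f)) z =
      -(4 * (Real.pi : ℂ) ^ 2) * (((inner ℝ z u : ℝ) : ℂ) ^ 2 * 𝓕 f z) := by
  have hg : (inner ℝ · u : V → ℝ).HasTemperateGrowth := by fun_prop
  rw [fourier_lineDerivOp_eq, fourier_lineDerivOp_eq]
  simp only [smul_apply, smulLeftCLM_apply_apply hg, smul_eq_mul, Complex.real_smul]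
  ring_nf
  rw [Complex.I_sq]
  ring

end FourierTransform

section OscillatoryIntegrals

variable {F G : ℂ → ℂ} {L L' : ℂ}

theorem HasOscIntegral.add (hF : HasOscIntegral F L) (hG : HasOscIntegral G L') :
    HasOscIntegral (fun z => F z + G z) (L + L') := by
  intro χ hχ
  simp only [mul_add]
  refine ⟨fun ε hε => ((hF χ hχ).1 ε hε).add ((hG χ hχ).1 ε hε),
    ((hF χ hχ).2.add (hG χ hχ).2).congr' ?_⟩
  filter_upwards [self_mem_nhdsWithin] with ε hε
  exact (integral_add ((hF χ hχ).1 ε hε) ((hG χ hχ).1 ε hε)).symm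

theorem HasOscIntegral.const_mul (hF : HasOscIntegral F L) (c : ℂ) :
    HasOscIntegral (fun z => c * F z) (c * L) := by
  intro χ hχ
  simp only [mul_left_comm _ c, integral_const_mul]
  exact ⟨fun ε hε => ((hF χ hχ).1 ε hε).const_mul c, (hF χ hχ).2.const_mul c⟩

theorem HasOscIntegral.comp_smul (hF : HasOscIntegral F L) {c : ℝ} (hc : 0 < c) :
    HasOscIntegral (fun z => F (c • z)) ((c ^ 2)⁻¹ • L) := by
  intro χ hχ
  let χ' := dilation c⁻¹ (inv_ne_zero hc.ne') χ
  have hχ' (ε : ℝ) (z : ℂ) : χ (ε • z) * F (c • z) = χ' (ε • c • z) * F (c • z) := by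
    rw [dilation_apply, smul_comm ε c, inv_smul_smul₀ hc.ne']
  obtain ⟨hint, hlim⟩ := hF χ' (by rwa [dilation_apply, smul_zero])
  simp only [hχ']
  refine ⟨fun ε hε => (hint ε hε).comp_smul hc.ne', (hlim.const_smul (c ^ 2)⁻¹).congr fun ε => ?_⟩
  rw [Measure.integral_comp_smul_of_nonneg volume (fun y : ℂ => χ' (ε • y) * F y) c (hR := hc.le),
    Complex.finrank_real_complex]

theorem HasOscIntegral.comp_linearIsometryEquiv (hF : HasOscIntegral F L) (e : ℂ ≃ₗᵢ[ℝ] ℂ) :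
    HasOscIntegral (fun z => F (e z)) L := by
  intro χ hχ
  let χ' : 𝓢(ℂ, ℂ) := compCLMOfContinuousLinearEquiv ℂ e.symm.toContinuousLinearEquiv χ
  have hχ' (ε : ℝ) (z : ℂ) : χ (ε • z) * F (e z) = χ' (ε • e z) * F (e z) := by
    change _ = χ (e.symm (ε • e z)) * _
    rw [map_smul e.symm, e.symm_apply_apply]
  obtain ⟨hint, hlim⟩ := hF χ' (by change χ (e.symm 0) = 1; rwa [map_zero])
  have he := e.toHomeomorph.measurableEmbedding
  simp only [hχ']
  exact ⟨fun ε hε => (e.measurePreserving.integrable_comp_emb he).2 (hint ε hε),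
    hlim.congr fun ε => (e.measurePreserving.integral_comp he fun y => χ' (ε • y) * F y).symm⟩

theorem hasOscIntegral_inner_sq_mul_fourier_schwartz (g : 𝓢(ℂ, ℂ)) (u : ℂ) :
    HasOscIntegral (fun z => ((inner ℝ z u : ℝ) : ℂ) ^ 2 * 𝓕 (g : ℂ → ℂ) z)
      (-(4 * (Real.pi : ℂ) ^ 2)⁻¹ * fderiv ℝ (fderiv ℝ g) 0 u u) := by
  have hmoment : (fun z : ℂ => ((inner ℝ z u : ℝ) : ℂ) ^ 2 * 𝓕 (g : ℂ → ℂ) z) =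
      fun z => -(4 * (Real.pi : ℂ) ^ 2)⁻¹ * 𝓕 (∂_{u} (∂_{u} g)) z := by
    ext z
    have hπ : (Real.pi : ℂ) ≠ 0 := by exact_mod_cast Real.pi_ne_zero
    rw [fourier_lineDeriv_lineDeriv, ← fourier_coe]
    field_simp
  rw [hmoment, ← lineDeriv_lineDeriv_apply, ← integral_fourier, ← integral_const_mul]
  exact hasOscIntegral_integral ((𝓕 (∂_{u} (∂_{u} g))).integrable.const_mul _)

theorem hasOscIntegral_inner_sq_mul_fourier_of_isLittleO {f : ℂ → ℂ} (hf : Integrable f)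
    (ho : f =o[𝓝 0] fun w => ‖w‖ ^ 2) (u : ℂ) :
    HasOscIntegral (fun z => ((inner ℝ z u : ℝ) : ℂ) ^ 2 * 𝓕 f z) 0 := by
  intro χ _
  have hg : (fun z : ℂ => ((inner ℝ z u : ℝ) : ℂ) ^ 2).HasTemperateGrowth :=
    (Complex.ofRealCLM.hasTemperateGrowth.comp
      (by fun_prop : (inner ℝ · u : ℂ → ℝ).HasTemperateGrowth)).pow 2
  let κ : 𝓢(ℂ, ℂ) := smulLeftCLM ℂ (fun z : ℂ => ((inner ℝ z u : ℝ) : ℂ) ^ 2) χ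
  have hκ (ε : ℝ) (hε : 0 < ε) (z : ℂ) : χ (ε • z) * (((inner ℝ z u : ℝ) : ℂ) ^ 2 * 𝓕 f z) =
      (ε ^ 2)⁻¹ • (dilation ε hε.ne' κ z * 𝓕 f z) := by
    rw [dilation_apply, smulLeftCLM_apply_apply hg, real_inner_smul_left, smul_eq_mul,
      Complex.real_smul (x := (ε ^ 2)⁻¹)]
    have : (ε : ℂ) ≠ 0 := by exact_mod_cast hε.ne'
    push_cast
    field_simp
  refine ⟨fun ε hε => ?_, ?_⟩
  · simp only [hκ ε hε]
    exact (integrable_schwartz_mul_fourier _ hf).smul (ε ^ 2)⁻¹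
  -- Moved to the cutoff, the Fourier transform yields the concentrating family `𝓕 κ (ε⁻¹ • w)`.
  · refine (tendsto_integral_schwartzMap_inv_smul_smul (𝓕 κ) hf ho).congr' ?_
    filter_upwards [self_mem_nhdsWithin] with ε (hε : 0 < ε)
    simp only [hκ ε hε, integral_smul, integral_schwartz_mul_fourier _ hf, fourier_dilation hε,
      smul_mul_assoc, smul_smul, smul_eq_mul, pow_add, mul_inv, Complex.finrank_real_complex]

theorem hasOscIntegral_inner_sq_mul_fourier {h : ℂ → ℂ} (hi : Integrable h)
    (hc : ContDiffAt ℝ 2 h 0) (u : ℂ) :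
    HasOscIntegral (fun z => ((inner ℝ z u : ℝ) : ℂ) ^ 2 * 𝓕 h z)
      (-(4 * (Real.pi : ℂ) ^ 2)⁻¹ * fderiv ℝ (fderiv ℝ h) 0 u u) := by
  obtain ⟨g, ho, hg⟩ := exists_schwartzMap_sub_isLittleO hc
  simp only [sub_zero] at ho
  have hR : Integrable fun w => h w - g w := hi.sub g.integrable
  have hsplit : 𝓕 h = fun z => 𝓕 (g : ℂ → ℂ) z + 𝓕 (fun w => h w - g w) z := by
    ext z
    simp only [Real.fourier_eq]
    rw [← integral_add ((Real.fourierIntegral_convergent_iff z).2 g.integrable)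
      ((Real.fourierIntegral_convergent_iff z).2 hR)]
    simp only [← smul_add, add_sub_cancel]
  have hsum := (hasOscIntegral_inner_sq_mul_fourier_schwartz g u).add
    (hasOscIntegral_inner_sq_mul_fourier_of_isLittleO hR ho u)
  simpa only [hsplit, mul_add, add_zero, hg] using hsum

end OscillatoryIntegrals

section Displacement

theorem iteratedDeriv_exp_I_mul (n : ℕ) :
    iteratedDeriv n (fun x : ℝ => Complex.exp (Complex.I * x)) =
      fun x : ℝ => Complex.I ^ n * Complex.exp (Complex.I * x) := by
  induction n with
  | zero => simp
  | succ n ih =>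
    ext x
    have h : HasDerivAt (fun x : ℝ => Complex.exp (Complex.I * x))
        (Complex.exp (Complex.I * x) * Complex.I) x := by
      simpa using ((hasDerivAt_id x).ofReal_comp.const_mul Complex.I).cexp
    rw [iteratedDeriv_succ, ih, (h.const_mul _).deriv]
    ring

theorem hasTemperateGrowth_exp_I_mul {E : Type*} [NormedAddCommGroup E] [NormedSpace ℝ E]
    {f : E → ℝ} (hf : f.HasTemperateGrowth) :
    (fun x => Complex.exp (Complex.I * f x)).HasTemperateGrowth := by
  have hexp : (fun x : ℝ => Complex.exp (Complex.I * x)).HasTemperateGrowth := by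
    refine ⟨(contDiff_const.mul Complex.ofRealCLM.contDiff).cexp, fun n => ⟨0, 1, fun x => ?_⟩⟩
    rw [norm_iteratedFDeriv_eq_norm_iteratedDeriv, iteratedDeriv_exp_I_mul]
    simp [mul_comm Complex.I, Complex.norm_exp_ofReal_mul_I]
  exact hexp.comp hf

/-- The displacement operator `D(z)` on the Schwartz space. -/
def displaceS (z : ℂ) : 𝓢(ℝ, ℂ) →L[ℂ] 𝓢(ℝ, ℂ) :=
  smulLeftCLM ℂ (fun x : ℝ => Complex.exp (Complex.I * ((pOf z * (x - qOf z / 2) : ℝ) : ℂ))) ∘L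
    compSubConstCLM ℂ (qOf z)

theorem displaceS_apply (z : ℂ) (φ : 𝓢(ℝ, ℂ)) (x : ℝ) :
    displaceS z φ x = displaceFun z φ x := by
  rw [displaceS, ContinuousLinearMap.comp_apply,
    smulLeftCLM_apply_apply (hasTemperateGrowth_exp_I_mul (by fun_prop)), compSubConstCLM_apply,
    smul_eq_mul, displaceFun]

theorem D_vec (z : ℂ) (φ : 𝓢(ℝ, ℂ)) : D z (vec φ) = vec (displaceS z φ) := by
  refine Lp.ext ?_
  filter_upwards [coeFn_D z (vec φ), displaceFun_congr z (φ.coeFn_toLp 2 volume),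
    (displaceS z φ).coeFn_toLp 2 volume] with x h1 h2 h3
  rw [h1, h2, h3, displaceS_apply]

theorem displaceFun_zero (φ : ℝ → ℂ) : displaceFun 0 φ = φ := by
  ext x
  simp [displaceFun, pOf, qOf]

theorem D_zero (φ : Hilb) : D 0 φ = φ := by
  refine Lp.ext ?_
  filter_upwards [coeFn_D 0 φ] with x hx
  rw [hx, displaceFun_zero]

theorem displaceFun_displaceFun (w z : ℂ) (φ : ℝ → ℂ) (x : ℝ) :
    displaceFun w (displaceFun z φ) x =
      Complex.exp (Complex.I * (w * conj z).im) * displaceFun (w + z) φ x := by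
  have hsqrt : (√2 : ℝ) * √2 = 2 := Real.mul_self_sqrt (by norm_num)
  have hx : x - qOf (w + z) = x - qOf w - qOf z := by
    simp only [qOf, Complex.add_re]
    ring
  simp only [displaceFun, hx, ← mul_assoc, ← Complex.exp_add, ← mul_add, ← Complex.ofReal_add]
  congr 4
  simp only [qOf, pOf, Complex.add_re, Complex.add_im, Complex.mul_im, Complex.conj_re,
    Complex.conj_im]
  linear_combination (w.im * z.re - w.re * z.im) / 2 * hsqrt

theorem D_D (w z : ℂ) (φ : Hilb) :
    D w (D z φ) = Complex.exp (Complex.I * (w * conj z).im) • D (w + z) φ := by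
  refine Lp.ext ?_
  filter_upwards [coeFn_D w (D z φ), displaceFun_congr w (coeFn_D z φ), coeFn_D (w + z) φ,
    Lp.coeFn_smul (Complex.exp (Complex.I * (w * conj z).im)) (D (w + z) φ)] with x h1 h2 h3 h4
  rw [h1, h2, h4, Pi.smul_apply, h3, displaceFun_displaceFun, smul_eq_mul]

theorem adjoint_D (z : ℂ) : ContinuousLinearMap.adjoint (D z) = D (-z) := by
  refine (ContinuousLinearMap.eq_adjoint_iff _ _ |>.2 fun φ ψ => ?_).symm
  have hinv : D z (D (-z) φ) = φ := by simp [D_D, D_zero, mul_comm z.re]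
  rw [← (displacement z).inner_map_map]
  exact congrArg (inner ℂ · (D z ψ)) hinv

theorem D_D_D_neg (z w : ℂ) (φ : Hilb) :
    D z (D w (D (-z) φ)) = Complex.exp (Complex.I * (2 * (z * conj w).im : ℝ)) • D w φ := by
  rw [D_D w, map_smul, D_D z, smul_smul, ← Complex.exp_add, ← mul_add, ← Complex.ofReal_add,
    show z + (w + -z) = w by ring]
  congr 4
  simp only [Complex.mul_im, Complex.conj_re, Complex.conj_im, Complex.add_re, Complex.add_im,
    Complex.neg_re, Complex.neg_im]
  ring

/-- The matrix element `⟨φ, D(w) ψ⟩`, as a function of `w`. -/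
def matEl (φ ψ : 𝓢(ℝ, ℂ)) (w : ℂ) : ℂ := inner ℂ (vec φ) (D w (vec ψ))

/-- Conjugating `D(w)` by `D(z)` only produces a phase, so that the matrix elements of `M(z)` form a
symplectic Fourier transform. Mathlib's `𝓕` pairs `w` with its argument by the Euclidean inner
product, normalised with `2π`: hence the rotation by `i` and the factor `π⁻¹`. -/
theorem inner_displaced {ϖ : ℂ → ℂ} {M : Hilb →L[ℂ] Hilb} (hM : IsWeightOperator ϖ M)
    (φ ψ : 𝓢(ℝ, ℂ)) (z : ℂ) :
    inner ℂ (vec φ) (displaced M z (vec ψ)) =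
      𝓕 (fun w => ϖ w * matEl φ ψ w / Real.pi) (Real.pi⁻¹ • (Complex.I * z)) := by
  have hphase (w : ℂ) : -2 * Real.pi * inner ℝ w (Real.pi⁻¹ • (Complex.I * z)) =
      2 * (z * conj w).im := by
    rw [real_inner_smul_right, Complex.inner, mul_assoc Complex.I, Complex.I_mul_re]
    field_simp
  have hpair (w : ℂ) : inner ℂ (D (-z) (vec φ)) (D w (D (-z) (vec ψ))) =
      Complex.exp (Complex.I * (2 * (z * conj w).im : ℝ)) * matEl φ ψ w := by
    rw [← adjoint_D, ContinuousLinearMap.adjoint_inner_left, adjoint_D, D_D_D_neg,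
      inner_smul_right, matEl]
  rw [displaced, ContinuousLinearMap.comp_apply, ContinuousLinearMap.comp_apply,
    ← ContinuousLinearMap.adjoint_inner_left, adjoint_D, D_vec, D_vec, (hM _ _).2, Real.fourier_eq']
  congr 1 with w
  rw [← D_vec, ← D_vec, hpair, hphase, smul_eq_mul, mul_comm Complex.I]
  ring

end Displacement

section Generator

theorem ofReal_sqrt_two_mul_self : ((√2 : ℝ) : ℂ) * (√2 : ℝ) = 2 := by
  exact_mod_cast Real.mul_self_sqrt zero_le_two

/-- The operator `D(w)⁻¹ ∂ᵤD(w)`, where `∂ᵤ` is the derivative in the direction `u`. It is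
`u a† - ū a`, up to the constant that the noncommutativity of `D(w)` and `D(u)` produces. -/
def generator (w u : ℂ) : Module.End ℂ 𝓢(ℝ, ℂ) :=
  u • opAdag - conj u • opA - (Complex.I * (w * conj u).im) • 1

theorem generator_eq (w u : ℂ) :
    generator w u = (√2 * Complex.I * u.im) • opQ - (√2 * Complex.I * u.re) • opP -
      (Complex.I * (w * conj u).im) • 1 := by
  have hsqrt : ((√2 : ℝ) : ℂ)⁻¹ * 2 = √2 := by
    rw [← ofReal_sqrt_two_mul_self]
    field_simp
  have hQ : u - conj u = 2 * Complex.I * u.im := by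
    rw [Complex.sub_conj]
    push_cast
    ring
  have hP : u + conj u = 2 * u.re := by rw [Complex.add_conj]; push_cast; ring
  rw [generator, ← hsqrt]
  congr 1
  simp only [opAdag, opA]
  match_scalars
  · linear_combination ((√2 : ℝ) : ℂ)⁻¹ * hQ
  · linear_combination -((√2 : ℝ) : ℂ)⁻¹ * Complex.I * hP

theorem generator_apply_eq_sub (w u : ℂ) (ψ : 𝓢(ℝ, ℂ)) :
    generator w u ψ = generator 0 u ψ - (Complex.I * (w * conj u).im) • ψ := by
  simp [generator]

theorem seminorm_generator_le (w u : ℂ) (ψ : 𝓢(ℝ, ℂ)) :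
    SchwartzMap.seminorm ℂ 0 0 (generator w u ψ) ≤
      ‖u‖ * (SchwartzMap.seminorm ℂ 0 0 (opAdag ψ) + SchwartzMap.seminorm ℂ 0 0 (opA ψ) +
        ‖w‖ * SchwartzMap.seminorm ℂ 0 0 ψ) := by
  have hphase : ‖Complex.I * ((w * conj u).im : ℂ)‖ ≤ ‖w‖ * ‖u‖ := by
    rw [norm_mul, Complex.norm_I, one_mul, Complex.norm_real, Real.norm_eq_abs]
    exact (Complex.abs_im_le_norm _).trans_eq (by rw [norm_mul, RCLike.norm_conj])
  calc SchwartzMap.seminorm ℂ 0 0 (generator w u ψ)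
      ≤ SchwartzMap.seminorm ℂ 0 0 (u • opAdag ψ) + SchwartzMap.seminorm ℂ 0 0 (conj u • opA ψ) +
        SchwartzMap.seminorm ℂ 0 0 ((Complex.I * (w * conj u).im) • ψ) :=
        (map_sub_le_add _ _ _).trans (add_le_add_left (map_sub_le_add _ _ _) _)
    _ ≤ ‖u‖ * SchwartzMap.seminorm ℂ 0 0 (opAdag ψ) + ‖u‖ * SchwartzMap.seminorm ℂ 0 0 (opA ψ) +
        ‖w‖ * ‖u‖ * SchwartzMap.seminorm ℂ 0 0 ψ := by
        simp only [map_smul_eq_mul, RCLike.norm_conj]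
        gcongr
    _ = _ := by ring

theorem displaceFun_generator (v w u : ℂ) (ψ : 𝓢(ℝ, ℂ)) (x : ℝ) :
    displaceFun v (generator w u ψ) x =
      √2 * Complex.I * (u.im * displaceFun v (opQ ψ) x - u.re * displaceFun v (opP ψ) x) -
        Complex.I * (w * conj u).im * displaceFun v ψ x := by
  simp only [generator_eq, displaceFun, sub_apply, smul_apply, LinearMap.sub_apply,
    LinearMap.smul_apply, Module.End.one_apply, smul_eq_mul]
  ring

/-- The real-linear map on `ℂ` with the value `p.1` at `1` and the value `p.2` at `I`, as a
function of `p`: it assembles a derivative from its two partial derivatives. -/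
def ofPartials : ℂ × ℂ →L[ℝ] ℂ →L[ℝ] ℂ :=
  (ContinuousLinearMap.smulRightL ℝ ℂ ℂ Complex.reCLM).coprod
    (ContinuousLinearMap.smulRightL ℝ ℂ ℂ Complex.imCLM)

theorem ofPartials_apply (p : ℂ × ℂ) (u : ℂ) : ofPartials p u = u.re * p.1 + u.im * p.2 := by
  simp [ofPartials]

theorem hasFDerivAt_displaceFun (ψ : 𝓢(ℝ, ℂ)) (x : ℝ) (w : ℂ) :
    HasFDerivAt (fun w => displaceFun w ψ x)
      (ofPartials (displaceFun w (generator w 1 ψ) x,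
        displaceFun w (generator w Complex.I ψ) x)) w := by
  have hq : HasFDerivAt qOf ((√2 : ℝ) • Complex.reCLM) w :=
    Complex.reCLM.hasFDerivAt.const_smul (√2 : ℝ)
  have hp : HasFDerivAt pOf ((√2 : ℝ) • Complex.imCLM) w :=
    Complex.imCLM.hasFDerivAt.const_smul (√2 : ℝ)
  have hphase : HasFDerivAt (fun w => Complex.I * ((pOf w * (x - qOf w / 2) : ℝ) : ℂ))
      (ofPartials (-Complex.I * w.im, Complex.I * (√2 * x - w.re))) w := by
    refine ((Complex.ofRealCLM.hasFDerivAt.comp w (hp.mul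
      ((hasFDerivAt_const x w).sub (hq.mul_const (2⁻¹ : ℝ))))).const_mul
        Complex.I).congr_fderiv (ContinuousLinearMap.ext fun v => ?_)
    simp [ofPartials_apply, qOf, pOf]
    linear_combination (-Complex.I * (v.re * w.im + w.re * v.im) / 2) * ofReal_sqrt_two_mul_self
  have hshift : HasFDerivAt (fun w => ψ (x - qOf w))
      (ofPartials (-√2 * deriv ψ (x - qOf w), 0)) w := by
    refine (HasFDerivAt.comp (g := ψ) w (ψ.hasDerivAt (x - qOf w)).hasFDerivAt
      ((hasFDerivAt_const x w).sub hq)).congr_fderiv (ContinuousLinearMap.ext fun v => ?_)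
    simp [ofPartials_apply]
    ring
  refine (hphase.cexp.mul hshift).congr_fderiv (ContinuousLinearMap.ext fun v => ?_)
  rw [add_apply, smul_apply, smul_apply, smul_apply]
  rw [ofPartials_apply, ofPartials_apply, ofPartials_apply, displaceFun_generator,
    displaceFun_generator]
  simp only [displaceFun, opP_apply, opQ_apply, qOf, smul_eq_mul, Complex.mul_im, Complex.conj_re,
    Complex.conj_im, Complex.one_re, Complex.one_im, Complex.I_re, Complex.I_im]
  push_cast
  generalize Complex.exp _ = e
  generalize deriv ψ _ = d
  generalize ψ _ = y
  linear_combination (-√2 * e * v.re * d) * Complex.I_mul_I +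
    Complex.I * w.re * e * y * v.im * ofReal_sqrt_two_mul_self

end Generator

section MatrixElements

theorem vec_add (φ ψ : 𝓢(ℝ, ℂ)) : vec (φ + ψ) = vec φ + vec ψ :=
  map_add (toLpCLM ℂ ℂ 2 volume) φ ψ

theorem vec_sub (φ ψ : 𝓢(ℝ, ℂ)) : vec (φ - ψ) = vec φ - vec ψ :=
  map_sub (toLpCLM ℂ ℂ 2 volume) φ ψ

theorem vec_smul (c : ℂ) (φ : 𝓢(ℝ, ℂ)) : vec (c • φ) = c • vec φ :=
  map_smul (toLpCLM ℂ ℂ 2 volume) c φ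

theorem matEl_zero (φ ψ : 𝓢(ℝ, ℂ)) : matEl φ ψ 0 = inner ℂ (vec φ) (vec ψ) := by
  rw [matEl, D_zero]

theorem matEl_eq_integral (φ ψ : 𝓢(ℝ, ℂ)) (w : ℂ) :
    matEl φ ψ w = ∫ x, conj (φ x) * displaceFun w ψ x := by
  rw [matEl, D_vec]
  refine (inner_toL2_toL2_eq φ (displaceS w ψ) volume).trans ?_
  simp only [RCLike.inner_apply, displaceS_apply, mul_comm]

theorem norm_displaceFun_le (w : ℂ) (ψ : 𝓢(ℝ, ℂ)) (x : ℝ) :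
    ‖displaceFun w ψ x‖ ≤ SchwartzMap.seminorm ℂ 0 0 ψ := by
  rw [norm_displaceFun]
  exact ψ.norm_le_seminorm ℂ _

theorem integrable_conj_mul_displaceFun (φ ψ : 𝓢(ℝ, ℂ)) (w : ℂ) :
    Integrable fun x => conj (φ x) * displaceFun w ψ x :=
  (Complex.conjCLE.integrable_comp_iff.2 φ.integrable).mul_bdd
    (aestronglyMeasurable_displaceFun w ψ.continuous.aestronglyMeasurable)
    (Eventually.of_forall (norm_displaceFun_le w ψ))

theorem matEl_generator (φ ψ : 𝓢(ℝ, ℂ)) (w u : ℂ) :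
    matEl φ (generator w u ψ) w =
      matEl φ (generator 0 u ψ) w - Complex.I * (w * conj u).im * matEl φ ψ w := by
  simp only [matEl, generator_apply_eq_sub w, vec_sub, vec_smul, map_sub, map_smul, inner_sub_right,
    inner_smul_right]

theorem hasFDerivAt_matEl (φ ψ : 𝓢(ℝ, ℂ)) (w : ℂ) :
    HasFDerivAt (matEl φ ψ)
      (ofPartials (matEl φ (generator w 1 ψ) w, matEl φ (generator w Complex.I ψ) w)) w := by
  let G (u v : ℂ) (x : ℝ) : ℂ := conj (φ x) * displaceFun v (generator v u ψ) x
  let C : ℝ := SchwartzMap.seminorm ℂ 0 0 (opAdag ψ) + SchwartzMap.seminorm ℂ 0 0 (opA ψ) +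
    (‖w‖ + 1) * SchwartzMap.seminorm ℂ 0 0 ψ
  have hG (u v : ℂ) : Integrable (G u v) := integrable_conj_mul_displaceFun φ _ v
  have hGC (u : ℂ) (hu : ‖u‖ = 1) {v : ℂ} (hv : v ∈ Metric.ball w 1) (x : ℝ) :
      ‖G u v x‖ ≤ ‖φ x‖ * C := by
    have hv' : ‖v‖ ≤ ‖w‖ + 1 :=
      (norm_le_norm_add_norm_sub w v).trans (by gcongr; exact (mem_ball_iff_norm'.1 hv).le)
    rw [norm_mul, RCLike.norm_conj]
    gcongr
    refine (norm_displaceFun_le v _ x).trans ((seminorm_generator_le v u ψ).trans ?_)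
    rw [hu, one_mul]
    simp only [C]
    gcongr
  have hmain := hasFDerivAt_integral_of_dominated_of_fderiv_le (μ := volume)
    (F := fun v x => conj (φ x) * displaceFun v ψ x)
    (F' := fun v x => ofPartials (G 1 v x, G Complex.I v x))
    (bound := fun x => ‖ofPartials‖ * (‖φ x‖ * C)) (Metric.ball_mem_nhds w one_pos)
    (Eventually.of_forall fun v => (integrable_conj_mul_displaceFun φ ψ v).1)
    (integrable_conj_mul_displaceFun φ ψ w)
    (ofPartials.integrable_comp ((hG 1 w).prodMk (hG Complex.I w))).1
    (Eventually.of_forall fun x v hv => (ofPartials.le_opNorm _).trans (by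
      gcongr
      exact norm_prod_le_iff.2 ⟨hGC 1 norm_one hv x, hGC Complex.I Complex.norm_I hv x⟩))
    ((φ.integrable.norm.mul_const C).const_mul _)
    (Eventually.of_forall fun x v _ =>
      ((hasFDerivAt_displaceFun ψ x v).const_mul (conj (φ x))).congr_fderiv
        (ContinuousLinearMap.ext fun u => by
          rw [smul_apply, ofPartials_apply, ofPartials_apply, smul_eq_mul]
          ring))
  rw [ofPartials.integral_comp_comm ((hG 1 w).prodMk (hG Complex.I w)),
    integral_pair (hG 1 w) (hG Complex.I w)] at hmain
  simp only [G, ← matEl_eq_integral] at hmain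
  exact hmain

theorem fderiv_matEl (φ ψ : 𝓢(ℝ, ℂ)) (w u : ℂ) :
    fderiv ℝ (matEl φ ψ) w u = matEl φ (generator w u ψ) w := by
  have hu : generator w u = (u.re : ℂ) • generator w 1 + (u.im : ℂ) • generator w Complex.I := by
    rw [generator_eq, generator_eq, generator_eq]
    match_scalars <;> simp <;> ring
  rw [(hasFDerivAt_matEl φ ψ w).fderiv, ofPartials_apply, hu]
  simp only [matEl, LinearMap.add_apply, LinearMap.smul_apply, vec_add, vec_smul, map_add, map_smul,
    inner_add_right, inner_smul_right]

theorem contDiff_matEl (φ : 𝓢(ℝ, ℂ)) (n : ℕ) (ψ : 𝓢(ℝ, ℂ)) : ContDiff ℝ n (matEl φ ψ) := by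
  induction n generalizing ψ with
  | zero =>
    rw [Nat.cast_zero, contDiff_zero]
    exact continuous_iff_continuousAt.2 fun w => (hasFDerivAt_matEl φ ψ w).continuousAt
  | succ n ih =>
    have hphase (u : ℂ) : ContDiff ℝ n fun w : ℂ => Complex.I * ((w * conj u).im : ℂ) :=
      contDiff_const.mul ((Complex.ofRealCLM ∘L Complex.imCLM).contDiff.comp
        (contDiff_id.mul contDiff_const))
    have hpartial (u : ℂ) : ContDiff ℝ n fun w => matEl φ (generator w u ψ) w := by
      simp only [matEl_generator φ ψ _ u]
      exact (ih _).sub ((hphase u).mul (ih ψ))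
    rw [Nat.cast_succ]
    exact contDiff_succ_iff_hasFDerivAt.2 ⟨_, ofPartials.contDiff.comp
      ((hpartial 1).prodMk (hpartial Complex.I)), hasFDerivAt_matEl φ ψ⟩

theorem fderiv_fderiv_matEl (φ ψ : 𝓢(ℝ, ℂ)) (u : ℂ) :
    fderiv ℝ (fderiv ℝ (matEl φ ψ)) 0 u u = matEl φ (generator 0 u (generator 0 u ψ)) 0 := by
  have hd (ψ : 𝓢(ℝ, ℂ)) : HasFDerivAt (matEl φ ψ) (fderiv ℝ (matEl φ ψ) 0) 0 :=
    (hasFDerivAt_matEl φ ψ 0).differentiableAt.hasFDerivAt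
  have hphase : HasFDerivAt (fun w : ℂ => Complex.I * ((w * conj u).im : ℂ))
      (Complex.I • (Complex.ofRealCLM ∘L Complex.imCLM ∘L
        (ContinuousLinearMap.mul ℝ ℂ).flip (conj u))) 0 :=
    (Complex.ofRealCLM ∘L Complex.imCLM ∘L
      (ContinuousLinearMap.mul ℝ ℂ).flip (conj u)).hasFDerivAt.const_mul Complex.I
  rw [← fderiv_fderiv_apply (contDiff_matEl φ 2 ψ).contDiffAt]
  simp only [fderiv_matEl, matEl_generator φ ψ _ u]
  rw [((hd (generator 0 u ψ)).fun_sub (hphase.fun_mul (hd ψ))).fderiv]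
  simp [fderiv_matEl, mul_comm (u.re : ℂ)]

end MatrixElements

section Wirtinger

variable {f : ℂ → ℂ} {w : ℂ}

theorem hasFDerivAt_wirtinger (hf : ContDiffAt ℝ 2 f w) (c : ℂ) :
    HasFDerivAt (fun w => (fderiv ℝ f w 1 + c * fderiv ℝ f w Complex.I) / 2)
      ((2 : ℂ)⁻¹ • (fderiv ℝ (fun w => fderiv ℝ f w 1) w +
        c • fderiv ℝ (fun w => fderiv ℝ f w Complex.I) w)) w := by
  have h (u : ℂ) : HasFDerivAt (fun w => fderiv ℝ f w u) (fderiv ℝ (fun w => fderiv ℝ f w u) w) w :=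
    (hasFDerivAt_fderiv_apply hf u).differentiableAt.hasFDerivAt
  simpa only [div_eq_inv_mul] using ((h 1).fun_add ((h Complex.I).const_mul c)).const_mul (2 : ℂ)⁻¹

theorem fderiv_dz (hf : ContDiffAt ℝ 2 f w) (v : ℂ) :
    fderiv ℝ (dz f) w v =
      (fderiv ℝ (fderiv ℝ f) w v 1 - Complex.I * fderiv ℝ (fderiv ℝ f) w v Complex.I) / 2 := by
  have hdz : dz f = fun w => (fderiv ℝ f w 1 + -Complex.I * fderiv ℝ f w Complex.I) / 2 := by
    ext w
    rw [dz, neg_mul, sub_eq_add_neg]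
  rw [hdz, (hasFDerivAt_wirtinger hf (-Complex.I)).fderiv]
  simp only [smul_apply, add_apply, smul_eq_mul, fderiv_fderiv_apply hf]
  ring

theorem fderiv_dzbar (hf : ContDiffAt ℝ 2 f w) (v : ℂ) :
    fderiv ℝ (dzbar f) w v =
      (fderiv ℝ (fderiv ℝ f) w v 1 + Complex.I * fderiv ℝ (fderiv ℝ f) w v Complex.I) / 2 := by
  refine (congrArg (· v) (hasFDerivAt_wirtinger hf Complex.I).fderiv).trans ?_
  simp only [smul_apply, add_apply, smul_eq_mul, fderiv_fderiv_apply hf]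
  ring

theorem dz_dzbar (hf : ContDiffAt ℝ 2 f w) :
    dz (dzbar f) w = (fderiv ℝ (fderiv ℝ f) w 1 1 +
      fderiv ℝ (fderiv ℝ f) w Complex.I Complex.I) / 4 := by
  rw [dz, fderiv_dzbar hf, fderiv_dzbar hf, (hf.isSymmSndFDerivAt (by simp)).eq 1 Complex.I]
  linear_combination (-fderiv ℝ (fderiv ℝ f) w Complex.I Complex.I / 4) * Complex.I_mul_I

theorem dz_dz_add_dzbar_dzbar (hf : ContDiffAt ℝ 2 f w) :
    dz (dz f) w + dzbar (dzbar f) w = (fderiv ℝ (fderiv ℝ f) w 1 1 -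
      fderiv ℝ (fderiv ℝ f) w Complex.I Complex.I) / 2 := by
  rw [dz, dzbar, fderiv_dz hf, fderiv_dz hf, fderiv_dzbar hf, fderiv_dzbar hf]
  linear_combination (fderiv ℝ (fderiv ℝ f) w Complex.I Complex.I / 2) * Complex.I_mul_I

end Wirtinger

section Quantization

variable {ϖ : ℂ → ℂ} {M : Hilb →L[ℂ] Hilb}

theorem IsQuantization.add {f g : ℂ → ℂ} {A B : Module.End ℂ 𝓢(ℝ, ℂ)} (hA : IsQuantization M f A)
    (hB : IsQuantization M g B) : IsQuantization M (fun z => f z + g z) (A + B) := by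
  intro φ ψ
  simp only [LinearMap.add_apply, vec_add, inner_add_right, add_mul, add_div]
  exact (hA φ ψ).add (hB φ ψ)

theorem IsQuantization.smul {f : ℂ → ℂ} {A : Module.End ℂ 𝓢(ℝ, ℂ)} (hA : IsQuantization M f A)
    (c : ℂ) : IsQuantization M (fun z => c * f z) (c • A) := by
  intro φ ψ
  simp only [LinearMap.smul_apply, vec_smul, inner_smul_right, mul_assoc, mul_div_assoc]
  simpa only [mul_div_assoc] using (hA φ ψ).const_mul c

/-- Multiplication by `i`, as an isometry of the plane. -/
def mulI : ℂ ≃ₗᵢ[ℝ] ℂ := rotation ⟨Complex.I, mem_sphere_zero_iff_norm.2 Complex.norm_I⟩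

theorem mulI_apply (z : ℂ) : mulI z = Complex.I * z := rfl

theorem hasOscIntegral_im_sq_mul_displaced (hM : IsWeightOperator ϖ M) (hϖ : ContDiffAt ℝ 2 ϖ 0)
    (φ ψ : 𝓢(ℝ, ℂ)) (u : ℂ) :
    HasOscIntegral (fun z : ℂ => ((z * conj u).im : ℂ) ^ 2 *
        inner ℂ (vec φ) (displaced M z (vec ψ)) / Real.pi)
      (-(1 / 4) * fderiv ℝ (fderiv ℝ fun w => ϖ w * matEl φ ψ w) 0 u u) := by
  have hπ : (Real.pi : ℂ) ≠ 0 := by exact_mod_cast Real.pi_ne_zero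
  have hc : ContDiffAt ℝ 2 (fun w => ϖ w * matEl φ ψ w) 0 :=
    hϖ.mul (contDiff_matEl φ 2 ψ).contDiffAt
  have hdiv : fderiv ℝ (fderiv ℝ fun w => ϖ w * matEl φ ψ w / Real.pi) 0 u u =
      fderiv ℝ (fderiv ℝ fun w => ϖ w * matEl φ ψ w) 0 u u * (Real.pi : ℂ)⁻¹ := by
    simp only [div_eq_mul_inv]
    rw [fderiv_fderiv_mul_apply hc contDiffAt_const]
    simp
  have hi : Integrable fun w => ϖ w * matEl φ ψ w / Real.pi := (hM φ ψ).1
  have h := (((hasOscIntegral_inner_sq_mul_fourier hi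
    (hc.div_const (Real.pi : ℂ)) u).comp_smul (inv_pos.2 Real.pi_pos)).comp_linearIsometryEquiv
      mulI).const_mul (Real.pi : ℂ)
  convert h using 1
  · ext z
    have hz : inner ℝ (Real.pi⁻¹ • (Complex.I * z)) u = -(Real.pi⁻¹ * (z * conj u).im) := by
      rw [real_inner_smul_left, real_inner_comm, Complex.inner, mul_assoc, Complex.I_mul_re,
        mul_neg]
    rw [inner_displaced hM, mulI_apply, hz]
    push_cast
    field_simp
  · rw [hdiv, Complex.real_smul]
    push_cast
    field_simp

theorem isQuantization_im_mul_conj_sq (hM : IsWeightOperator ϖ M) (hϖ : ContDiffAt ℝ 2 ϖ 0)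
    (u : ℂ) :
    IsQuantization M (fun z => ((z * conj u).im : ℂ) ^ 2)
      (-(1 / 4 : ℂ) • (ϖ 0 • generator 0 u ^ 2 + (2 * fderiv ℝ ϖ 0 u) • generator 0 u +
        fderiv ℝ (fderiv ℝ ϖ) 0 u u • 1)) := by
  intro φ ψ
  have h := hasOscIntegral_im_sq_mul_displaced hM hϖ φ ψ u
  rw [fderiv_fderiv_mul_apply hϖ (contDiff_matEl φ 2 ψ).contDiffAt, fderiv_matEl,
    fderiv_fderiv_matEl, matEl_zero, matEl_zero, matEl_zero] at h
  convert h using 1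
  simp only [LinearMap.smul_apply, LinearMap.add_apply, pow_two, Module.End.mul_apply,
    Module.End.one_apply, vec_smul, vec_add, inner_smul_right, inner_add_right]
  ring

theorem opP_mul_opQ : opP * opQ = opQ * opP - Complex.I • (1 : Module.End ℂ 𝓢(ℝ, ℂ)) := by
  ext ψ x
  have h : HasDerivAt (opQ ψ) (1 * ψ x + x * deriv ψ x) x :=
    ((hasDerivAt_id x).ofReal_comp.mul (ψ.hasDerivAt x)).congr_of_eventuallyEq
      (Eventually.of_forall (opQ_apply ψ))
  change opP (opQ ψ) x = opQ (opP ψ) x - Complex.I * ψ x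
  rw [opP_apply, opQ_apply, opP_apply, h.deriv]
  ring

theorem inv_sqrt_two_mul_self : ((√2 : ℝ) : ℂ)⁻¹ * ((√2 : ℝ) : ℂ)⁻¹ = 1 / 2 := by
  rw [← mul_inv, ofReal_sqrt_two_mul_self, one_div]

theorem opA_mul_opAdag : opA * opAdag = opAdag * opA + 1 := by
  rw [opA, opAdag, smul_mul_smul_comm, smul_mul_smul_comm, inv_sqrt_two_mul_self]
  simp only [add_mul, sub_mul, mul_add, mul_sub, smul_mul_assoc, mul_smul_comm, opP_mul_opQ,
    smul_sub, smul_smul]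
  match_scalars
  · ring
  · ring
  · linear_combination -Complex.I_mul_I
  · ring

theorem sqrt_two_mul_I_sq : ((√2 : ℝ) * Complex.I) ^ 2 = -2 := by
  rw [mul_pow, pow_two, ofReal_sqrt_two_mul_self, Complex.I_sq, mul_neg_one]

theorem generator_zero (u : ℂ) : generator 0 u = u • opAdag - conj u • opA := by
  simp [generator]

theorem generator_zero_one : generator 0 1 = -(√2 * Complex.I) • opP := by
  simp [generator_eq]

theorem generator_zero_I : generator 0 Complex.I = (√2 * Complex.I) • opQ := by
  simp [generator_eq]

theorem isQuantization_norm_sq (hM : IsWeightOperator ϖ M) (hϖ : ContDiffAt ℝ 2 ϖ 0) :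
    IsQuantization M (fun z => (‖z‖ ^ 2 : ℝ))
      (ϖ 0 • (opAdag * opA) + dz ϖ 0 • opA - dzbar ϖ 0 • opAdag
        + (ϖ 0 / 2 - dz (dzbar ϖ) 0) • 1) := by
  have hone : generator 0 1 = opAdag - opA := by simp [generator_zero]
  have hI : generator 0 Complex.I = Complex.I • (opAdag + opA) := by
    simp [generator_zero, smul_add]
  have hsq : generator 0 1 ^ 2 + generator 0 Complex.I ^ 2 =
      -(4 : ℂ) • (opAdag * opA) - (2 : ℂ) • 1 := by
    rw [hone, hI, smul_pow, Complex.I_sq]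
    simp only [pow_two, sub_mul, add_mul, mul_sub, mul_add, opA_mul_opAdag]
    module
  convert (isQuantization_im_mul_conj_sq hM hϖ 1).add
    (isQuantization_im_mul_conj_sq hM hϖ Complex.I) using 1
  · ext z
    rw [Complex.sq_norm, Complex.normSq_apply]
    simp only [map_one, mul_one, Complex.conj_I, mul_neg, Complex.neg_im, Complex.mul_im,
      Complex.I_im, Complex.I_re, mul_zero, add_zero, Complex.ofReal_add, Complex.ofReal_mul,
      Complex.ofReal_neg, neg_sq]
    ring
  · rw [dz_dzbar hϖ, dz, dzbar]
    linear_combination (norm := module) (ϖ 0 / 4) • hsq + (fderiv ℝ ϖ 0 1 / 2) • hone +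
      (fderiv ℝ ϖ 0 Complex.I / 2) • hI

theorem isQuantization_qOf_sq (hM : IsWeightOperator ϖ M) (hϖ : ContDiffAt ℝ 2 ϖ 0) :
    IsQuantization M (fun z => (qOf z ^ 2 : ℝ))
      (ϖ 0 • opQ ^ 2 + (√2 * (dz ϖ 0 - dzbar ϖ 0)) • opQ +
        (-dz (dzbar ϖ) 0 + 1 / 2 * (dz (dz ϖ) 0 + dzbar (dzbar ϖ) 0)) • 1) := by
  convert (isQuantization_im_mul_conj_sq hM hϖ Complex.I).smul 2 using 1
  · ext z
    rw [qOf, mul_pow, Real.sq_sqrt zero_le_two]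
    simp
  · rw [dz_dzbar hϖ, dz_dz_add_dzbar_dzbar hϖ, dz, dzbar, generator_zero_I, smul_pow]
    match_scalars
    · linear_combination (ϖ 0 / 2) * sqrt_two_mul_I_sq
    · ring
    · ring

theorem isQuantization_pOf_sq (hM : IsWeightOperator ϖ M) (hϖ : ContDiffAt ℝ 2 ϖ 0) :
    IsQuantization M (fun z => (pOf z ^ 2 : ℝ))
      (ϖ 0 • opP ^ 2 + (√2 * Complex.I * (dz ϖ 0 + dzbar ϖ 0)) • opP +
        (-dz (dzbar ϖ) 0 - 1 / 2 * (dz (dz ϖ) 0 + dzbar (dzbar ϖ) 0)) • 1) := by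
  convert (isQuantization_im_mul_conj_sq hM hϖ 1).smul 2 using 1
  · ext z
    rw [pOf, mul_pow, Real.sq_sqrt zero_le_two]
    simp
  · rw [dz_dzbar hϖ, dz_dz_add_dzbar_dzbar hϖ, dz, dzbar, generator_zero_one, smul_pow]
    match_scalars
    · linear_combination (ϖ 0 / 2) * sqrt_two_mul_I_sq
    · ring
    · ring

end Quantization

section Adjoints

theorem IsQuantization.unique {M : Hilb →L[ℂ] Hilb} {f : ℂ → ℂ} {A B : Module.End ℂ 𝓢(ℝ, ℂ)}
    (hA : IsQuantization M f A) (hB : IsQuantization M f B) : A = B := by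
  refine LinearMap.ext fun ψ => injective_toLp 2 (volume : Measure ℝ) (sub_eq_zero.1 ?_)
  have h : inner ℂ (vec (A ψ - B ψ)) (vec (A ψ) - vec (B ψ)) = 0 := by
    rw [inner_sub_right, sub_eq_zero]
    exact (hA _ ψ).unique (hB _ ψ)
  exact inner_self_eq_zero.1 (vec_sub (A ψ) (B ψ) ▸ h)

theorem inner_vec (φ ψ : 𝓢(ℝ, ℂ)) : inner ℂ (vec φ) (vec ψ) = ∫ x, ψ x * conj (φ x) :=
  inner_toL2_toL2_eq φ ψ volume

theorem inner_opQ (φ ψ : 𝓢(ℝ, ℂ)) :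
    inner ℂ (vec (opQ φ)) (vec ψ) = inner ℂ (vec φ) (vec (opQ ψ)) := by
  rw [inner_vec, inner_vec]
  congr 1 with x
  rw [opQ_apply, opQ_apply, map_mul, Complex.conj_ofReal]
  ring

theorem inner_opP (φ ψ : 𝓢(ℝ, ℂ)) :
    inner ℂ (vec (opP φ)) (vec ψ) = inner ℂ (vec φ) (vec (opP ψ)) := by
  let φc : 𝓢(ℝ, ℂ) := φ.postcompCLM (Complex.conjCLE : ℂ →L[ℝ] ℂ)
  have hφc (x : ℝ) : φc x = conj (φ x) := rfl
  have hderiv (x : ℝ) : deriv φc x = conj (deriv φ x) :=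
    ((Complex.conjCLE : ℂ →L[ℝ] ℂ).hasFDerivAt.comp_hasDerivAt x (φ.hasDerivAt x)).deriv
  have hparts := integral_mul_deriv_eq_neg_deriv_mul φc ψ
  simp only [hφc, hderiv] at hparts
  calc inner ℂ (vec (opP φ)) (vec ψ)
      = Complex.I * ∫ x, conj (deriv φ x) * ψ x := by
        rw [inner_vec, ← integral_const_mul]
        congr 1 with x
        rw [opP_apply, map_mul, map_neg, Complex.conj_I]
        ring
    _ = -Complex.I * ∫ x, conj (φ x) * deriv ψ x := by rw [hparts, mul_neg, neg_mul, neg_neg]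
    _ = inner ℂ (vec φ) (vec (opP ψ)) := by
        rw [inner_vec, ← integral_const_mul]
        congr 1 with x
        rw [opP_apply]
        ring

theorem inner_opA (φ ψ : 𝓢(ℝ, ℂ)) :
    inner ℂ (vec (opA φ)) (vec ψ) = inner ℂ (vec φ) (vec (opAdag ψ)) := by
  simp only [opA, opAdag, LinearMap.smul_apply, LinearMap.add_apply, LinearMap.sub_apply, vec_smul,
    vec_add, vec_sub, inner_smul_left, inner_smul_right, inner_add_left, inner_sub_right,
    inner_opQ, inner_opP, map_inv₀, Complex.conj_ofReal, Complex.conj_I]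
  ring

end Adjoints

section Minima

variable {B B' : Module.End ℂ 𝓢(ℝ, ℂ)}

theorem expect_mul_add_smul
    (hB : ∀ φ ψ, inner ℂ (vec (B φ)) (vec ψ) = inner ℂ (vec φ) (vec (B' ψ))) (m : ℝ)
    (φ : 𝓢(ℝ, ℂ)) :
    expect (B' * B + (m : ℂ) • 1) φ = ((‖vec (B φ)‖ ^ 2 + m * ‖vec φ‖ ^ 2 : ℝ) : ℂ) := by
  rw [expect, LinearMap.add_apply, LinearMap.smul_apply, Module.End.mul_apply,
    Module.End.one_apply, vec_add, vec_smul, inner_add_right, inner_smul_right, ← hB,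
    inner_self_eq_norm_sq_to_K, inner_self_eq_norm_sq_to_K]
  push_cast
  rfl

theorem isMinOf_mul_add_smul
    (hB : ∀ φ ψ, inner ℂ (vec (B φ)) (vec ψ) = inner ℂ (vec φ) (vec (B' ψ)))
    (hsmall : ∀ η > 0, ∃ φ, vec φ ≠ 0 ∧ ‖vec (B φ)‖ ≤ η * ‖vec φ‖) (m : ℝ) :
    IsMinOf (B' * B + (m : ℂ) • 1) m := by
  refine ⟨fun φ => by rw [expect_mul_add_smul hB, Complex.ofReal_im], ?_, fun b hb => ?_⟩
  · rintro r ⟨φ, hφ, rfl⟩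
    rw [expect_mul_add_smul hB, Complex.ofReal_re, hφ, one_pow, mul_one]
    exact le_add_of_nonneg_left (sq_nonneg _)
  · refine le_of_forall_pos_le_add fun η hη => ?_
    obtain ⟨φ, hφ, hle⟩ := hsmall (√η) (Real.sqrt_pos.2 hη)
    have hpos : 0 < ‖vec φ‖ := norm_pos_iff.2 hφ
    have hnorm (ψ : 𝓢(ℝ, ℂ)) :
        ‖vec (((‖vec φ‖⁻¹ : ℝ) : ℂ) • ψ)‖ = ‖vec φ‖⁻¹ * ‖vec ψ‖ := by
      rw [vec_smul, norm_smul, Complex.norm_real, norm_inv, norm_norm]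
    have hunit : ‖vec (((‖vec φ‖⁻¹ : ℝ) : ℂ) • φ)‖ = 1 := by
      rw [hnorm, inv_mul_cancel₀ hpos.ne']
    have hsq : (‖vec φ‖⁻¹ * ‖vec (B φ)‖) ^ 2 ≤ η := by
      rw [← Real.sq_sqrt hη.le]
      gcongr
      rwa [inv_mul_le_iff₀ hpos, mul_comm]
    refine (hb ⟨_, hunit, rfl⟩).trans ?_
    rw [expect_mul_add_smul hB, Complex.ofReal_re, hunit, map_smul, hnorm]
    linarith

theorem norm_vec_dilation (s : ℝ) (hs : s ≠ 0) (φ : 𝓢(ℝ, ℂ)) :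
    ‖vec (dilation s hs φ)‖ = √|s⁻¹| * ‖vec φ‖ := by
  have hsq (φ : 𝓢(ℝ, ℂ)) : ((‖vec φ‖ ^ 2 : ℝ) : ℂ) = ∫ x, φ x * conj (φ x) := by
    rw [← inner_vec, inner_self_eq_norm_sq_to_K]
    push_cast
    rfl
  have h : ‖vec (dilation s hs φ)‖ ^ 2 = |s⁻¹| * ‖vec φ‖ ^ 2 := by
    apply Complex.ofReal_injective
    rw [hsq, Complex.ofReal_mul, hsq]
    exact Measure.integral_comp_mul_left (fun x => φ x * conj (φ x)) s
  rw [← Real.sqrt_sq (norm_nonneg (vec (dilation s hs φ))), h, Real.sqrt_mul (abs_nonneg _),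
    Real.sqrt_sq (norm_nonneg _)]

theorem opQ_dilation (s : ℝ) (hs : s ≠ 0) (φ : 𝓢(ℝ, ℂ)) :
    opQ (dilation s hs φ) = ((s⁻¹ : ℝ) : ℂ) • dilation s hs (opQ φ) := by
  ext x
  have : (s : ℂ) ≠ 0 := by exact_mod_cast hs
  rw [smul_apply, opQ_apply, dilation_apply, dilation_apply, opQ_apply]
  push_cast
  simp only [smul_eq_mul, Complex.ofReal_mul]
  field_simp

theorem opP_dilation (s : ℝ) (hs : s ≠ 0) (φ : 𝓢(ℝ, ℂ)) :
    opP (dilation s hs φ) = (s : ℂ) • dilation s hs (opP φ) := by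
  ext x
  have h : HasDerivAt (dilation s hs φ) (s • deriv φ (s * x)) x :=
    HasDerivAt.scomp (g₁ := φ) (h := fun y => s * y) x (φ.hasDerivAt (s * x))
      (by simpa using (hasDerivAt_id x).const_mul s)
  rw [smul_apply, opP_apply, dilation_apply, opP_apply, h.deriv, Complex.real_smul, smul_eq_mul,
    smul_eq_mul]
  ring

theorem exists_norm_le_of_dilation {c : ℝ → ℝ} (hc : ∀ η > 0, ∃ s, s ≠ 0 ∧ |c s| ≤ η)
    (hB : ∀ s (hs : s ≠ 0) φ, B (dilation s hs φ) = (c s : ℂ) • dilation s hs (B φ))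
    {φ : 𝓢(ℝ, ℂ)} (hφ : vec φ ≠ 0) {η : ℝ} (hη : 0 < η) :
    ∃ φ, vec φ ≠ 0 ∧ ‖vec (B φ)‖ ≤ η * ‖vec φ‖ := by
  obtain ⟨s, hs, hcs⟩ := hc (η * ‖vec φ‖ / (‖vec (B φ)‖ + 1)) (by positivity)
  refine ⟨dilation s hs φ, norm_pos_iff.1 ?_, ?_⟩
  · rw [norm_vec_dilation]
    positivity
  · have hle : |c s| * ‖vec (B φ)‖ ≤ η * ‖vec φ‖ := by
      rw [le_div_iff₀ (by positivity)] at hcs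
      exact (mul_le_mul_of_nonneg_left (lt_add_one _).le (abs_nonneg _)).trans hcs
    rw [hB, vec_smul, norm_smul, norm_vec_dilation, norm_vec_dilation, Complex.norm_real,
      Real.norm_eq_abs, mul_left_comm, mul_left_comm η]
    gcongr

end Minima

section Gaussian

open Polynomial in
theorem exists_polynomial_mul_gaussian_le (p : ℝ[X]) :
    ∃ C, ∀ x : ℝ, |p.eval x| * Real.exp (-(x ^ 2 / 2)) ≤ C := by
  induction p using Polynomial.induction_on' with
  | add p q hp hq =>
    obtain ⟨C, hC⟩ := hp
    obtain ⟨C', hC'⟩ := hq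
    refine ⟨C + C', fun x => ?_⟩
    calc |(p + q).eval x| * Real.exp (-(x ^ 2 / 2))
        ≤ (|p.eval x| + |q.eval x|) * Real.exp (-(x ^ 2 / 2)) := by
          rw [eval_add]
          gcongr
          exact abs_add_le _ _
      _ ≤ C + C' := by
          rw [add_mul]
          exact add_le_add (hC x) (hC' x)
  | monomial n a =>
    refine ⟨|a| * (1 + 2 ^ n * n.factorial), fun x => ?_⟩
    rw [eval_monomial, abs_mul, abs_pow, mul_assoc, Real.exp_neg, ← div_eq_mul_inv]
    gcongr
    rw [div_le_iff₀ (Real.exp_pos _)]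
    have hpow : (x ^ 2) ^ n ≤ 2 ^ n * n.factorial * Real.exp (x ^ 2 / 2) := by
      have h := Real.pow_div_factorial_le_exp (x ^ 2 / 2) (by positivity) n
      rwa [div_pow, div_div, div_le_iff₀' (by positivity)] at h
    have habs : |x| ^ n ≤ 1 + (x ^ 2) ^ n := by
      rw [← sq_abs, ← pow_mul, mul_comm 2 n, pow_mul]
      nlinarith [sq_nonneg (|x| ^ n - 1)]
    linarith [Real.one_le_exp (x := x ^ 2 / 2) (by positivity)]

/-- The Gaussian `e^{-x²/2}` as a real Schwartz function. -/
def realGauss : 𝓢(ℝ, ℝ) where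
  toFun x := Real.exp (-(x ^ 2 / 2))
  smooth' := by fun_prop
  decay' k n := by
    obtain ⟨C, hC⟩ := exists_polynomial_mul_gaussian_le
      (Polynomial.X ^ k * (Polynomial.hermite n).map (algebraMap ℤ ℝ))
    refine ⟨C, fun x => le_trans (le_of_eq ?_) (hC x)⟩
    rw [norm_iteratedFDeriv_eq_norm_iteratedDeriv, iteratedDeriv_eq_iterate,
      Polynomial.deriv_gaussian_eq_hermite_mul_gaussian, Polynomial.aeval_def,
      ← Polynomial.eval_map]
    simp [abs_mul, mul_assoc]

/-- The unnormalised ground state `e^{-x²/2}` of the harmonic oscillator. -/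
def gauss : 𝓢(ℝ, ℂ) := realGauss.postcompCLM Complex.ofRealCLM

theorem gauss_apply (x : ℝ) : gauss x = (Real.exp (-(x ^ 2 / 2)) : ℂ) := rfl

theorem gauss_ne_zero : gauss ≠ 0 := fun h => by
  simpa [gauss_apply] using congrArg (fun φ : 𝓢(ℝ, ℂ) => φ 0) h

theorem vec_zero : vec 0 = 0 := map_zero (toLpCLM ℂ ℂ 2 (volume : Measure ℝ))

theorem vec_gauss_ne_zero : vec gauss ≠ 0 := fun h =>
  gauss_ne_zero (injective_toLp 2 (volume : Measure ℝ) (h.trans vec_zero.symm))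

theorem opA_gauss : opA gauss = 0 := by
  ext x
  have h : HasDerivAt (fun x : ℝ => Real.exp (-(x ^ 2 / 2))) (Real.exp (-(x ^ 2 / 2)) * -x) x := by
    convert ((hasDerivAt_pow 2 x).div_const 2).fun_neg.exp using 2
    norm_num
  have hderiv : deriv gauss x = (Real.exp (-(x ^ 2 / 2)) * -x : ℝ) := h.ofReal_comp.deriv
  change ((√2 : ℝ) : ℂ)⁻¹ * (opQ gauss x + Complex.I * opP gauss x) = 0
  rw [opQ_apply, opP_apply, hderiv, gauss_apply]
  push_cast
  linear_combination ((√2 : ℝ) : ℂ)⁻¹ * Complex.exp (-(x ^ 2 / 2)) * x * Complex.I_mul_I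

end Gaussian

section Energies

theorem isGroundStateEnergy_oscillator (m : ℝ) :
    IsGroundStateEnergy (opAdag * opA + (m : ℂ) • 1) m := by
  refine ⟨isMinOf_mul_add_smul inner_opA (fun η hη => ⟨gauss, vec_gauss_ne_zero, ?_⟩) m, ?_⟩
  · rw [opA_gauss, vec_zero, norm_zero]
    positivity
  · refine Module.End.hasEigenvalue_of_hasEigenvector (x := gauss)
      (Module.End.hasEigenvector_iff.2 ⟨Module.End.mem_eigenspace_iff.2 ?_, gauss_ne_zero⟩)
    rw [LinearMap.add_apply, Module.End.mul_apply, opA_gauss, map_zero, zero_add,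
      LinearMap.smul_apply, Module.End.one_apply]

theorem isMinOf_opQ_sq (m : ℝ) : IsMinOf (opQ ^ 2 + (m : ℂ) • 1) m := by
  rw [pow_two]
  refine isMinOf_mul_add_smul inner_opQ (fun η => exists_norm_le_of_dilation (c := fun s => s⁻¹)
    (fun η hη => ⟨η⁻¹, (inv_pos.2 hη).ne', ?_⟩) opQ_dilation vec_gauss_ne_zero) m
  rw [inv_inv, abs_of_pos hη]

theorem isMinOf_opP_sq (m : ℝ) : IsMinOf (opP ^ 2 + (m : ℂ) • 1) m := by
  rw [pow_two]
  refine isMinOf_mul_add_smul inner_opP (fun η => exists_norm_le_of_dilation (c := fun s => s)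
    (fun η hη => ⟨η, hη.ne', ?_⟩) opP_dilation vec_gauss_ne_zero) m
  rw [abs_of_pos hη]

theorem exists_energies {s t : ℂ} (hs : s.im = 0) (ht : t.im = 0) :
    ∃ E₀ mq mp Em : ℝ,
      IsGroundStateEnergy (opAdag * opA + (1 / 2 - s) • 1) E₀ ∧
      IsMinOf (opQ ^ 2 + (-s + 1 / 2 * t) • 1) mq ∧
      IsMinOf (opP ^ 2 + (-s - 1 / 2 * t) • 1) mp ∧
      Em = (mq + mp) / 2 ∧ (E₀ : ℂ) = 1 / 2 - s ∧ (Em : ℂ) = -s ∧ E₀ - Em = 1 / 2 := by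
  obtain ⟨s, rfl⟩ : ∃ r : ℝ, (r : ℂ) = s := ⟨s.re, Complex.ext rfl hs.symm⟩
  obtain ⟨t, rfl⟩ : ∃ r : ℝ, (r : ℂ) = t := ⟨t.re, Complex.ext rfl ht.symm⟩
  refine ⟨1 / 2 - s, -s + 1 / 2 * t, -s - 1 / 2 * t, -s, ?_, ?_, ?_, by ring, by push_cast; rfl,
    by push_cast; rfl, by ring⟩
  · simpa using isGroundStateEnergy_oscillator (1 / 2 - s)
  · simpa using isMinOf_opQ_sq (-s + 1 / 2 * t)
  · simpa using isMinOf_opP_sq (-s - 1 / 2 * t)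

end Energies

section RegularWeights

theorem fderiv_zero_of_even {E F : Type*} [NormedAddCommGroup E] [NormedSpace ℝ E]
    [NormedAddCommGroup F] [NormedSpace ℝ F] {f : E → F} (hf : ∀ z, f (-z) = f z) :
    fderiv ℝ f 0 = 0 := by
  have h := (ContinuousLinearEquiv.neg ℝ (M := E)).comp_right_fderiv (f := f) (x := 0)
  rw [show f ∘ ContinuousLinearEquiv.neg ℝ = f from funext hf, map_zero] at h
  have := IsAddTorsionFree.of_isTorsionFree ℝ F
  exact ContinuousLinearMap.ext fun u => self_eq_neg.1 <| by
    simpa using congrArg (fun L : E →L[ℝ] F => L u) h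

theorem fderiv_apply_im_eq_zero {E : Type*} [NormedAddCommGroup E] [NormedSpace ℝ E] {f : E → ℂ}
    (hf : ∀ w, (f w).im = 0) (w u : E) : (fderiv ℝ f w u).im = 0 := by
  have h := Complex.conjCLE.comp_fderiv (f := f) (x := w)
  rw [show Complex.conjCLE ∘ f = f from funext fun w => Complex.conj_eq_iff_im.2 (hf w)] at h
  exact Complex.conj_eq_iff_im.1 (congrArg (fun L : E →L[ℝ] ℂ => L u) h).symm

theorem fderiv_fderiv_apply_im_eq_zero {E : Type*} [NormedAddCommGroup E] [NormedSpace ℝ E]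
    {f : E → ℂ} {w : E} (hf : ContDiffAt ℝ 2 f w) (him : ∀ w, (f w).im = 0) (u v : E) :
    (fderiv ℝ (fderiv ℝ f) w u v).im = 0 := by
  rw [← fderiv_fderiv_apply hf]
  exact fderiv_apply_im_eq_zero (fun w => fderiv_apply_im_eq_zero him w v) w u

variable {ϖ : ℂ → ℂ}

theorem IsRegularWeight.dz_zero (h : IsRegularWeight ϖ) : dz ϖ 0 = 0 := by
  simp [dz, fderiv_zero_of_even h.even]

theorem IsRegularWeight.dzbar_zero (h : IsRegularWeight ϖ) : dzbar ϖ 0 = 0 := by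
  simp [dzbar, fderiv_zero_of_even h.even]

theorem IsRegularWeight.im_eq_zero (h : IsRegularWeight ϖ) (z : ℂ) : (ϖ z).im = 0 :=
  Complex.conj_eq_iff_im.1 (h.real z)

theorem IsRegularWeight.dz_dzbar_im (h : IsRegularWeight ϖ) {w : ℂ} (hϖ : ContDiffAt ℝ 2 ϖ w) :
    (dz (dzbar ϖ) w).im = 0 := by
  simp [dz_dzbar hϖ, fderiv_fderiv_apply_im_eq_zero hϖ h.im_eq_zero]

theorem IsRegularWeight.dz_dz_add_dzbar_dzbar_im (h : IsRegularWeight ϖ) {w : ℂ}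
    (hϖ : ContDiffAt ℝ 2 ϖ w) : (dz (dz ϖ) w + dzbar (dzbar ϖ) w).im = 0 := by
  simp [dz_dz_add_dzbar_dzbar hϖ, fderiv_fderiv_apply_im_eq_zero hϖ h.im_eq_zero]

end RegularWeights

end IntegralQuantization

end

theorem mainTheorem4_general {ϖ : ℂ → ℂ} {M : Hilb →L[ℂ] Hilb} (hM : IsWeightOperator ϖ M)
    (hϖ : ContDiffAt ℝ 2 ϖ 0) :
    IsQuantization M (fun z => (‖z‖ ^ 2 : ℝ))
      (ϖ 0 • (opAdag * opA) + dz ϖ 0 • opA - dzbar ϖ 0 • opAdag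
        + (ϖ 0 / 2 - dz (dzbar ϖ) 0) • 1) ∧
    IsQuantization M (fun z => (qOf z ^ 2 : ℝ))
      (ϖ 0 • opQ ^ 2 + (√2 * (dz ϖ 0 - dzbar ϖ 0)) • opQ
        + (-dz (dzbar ϖ) 0 + 1 / 2 * (dz (dz ϖ) 0 + dzbar (dzbar ϖ) 0)) • 1) ∧
    IsQuantization M (fun z => (pOf z ^ 2 : ℝ))
      (ϖ 0 • opP ^ 2 + (√2 * Complex.I * (dz ϖ 0 + dzbar ϖ 0)) • opP
        + (-dz (dzbar ϖ) 0 - 1 / 2 * (dz (dz ϖ) 0 + dzbar (dzbar ϖ) 0)) • 1) ∧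
    (ϖ 0 = 1 → dz ϖ 0 = 0 → dzbar ϖ 0 = 0 → (dz (dzbar ϖ) 0).im = 0 →
      (dz (dz ϖ) 0 + dzbar (dzbar ϖ) 0).im = 0 →
      ∀ H Aq Ap : Module.End ℂ 𝓢(ℝ, ℂ),
        IsQuantization M (fun z => (‖z‖ ^ 2 : ℝ)) H →
        IsQuantization M (fun z => (qOf z ^ 2 : ℝ)) Aq →
        IsQuantization M (fun z => (pOf z ^ 2 : ℝ)) Ap →
        ∃ E₀ mq mp Em : ℝ,
          IsGroundStateEnergy H E₀ ∧ IsMinOf Aq mq ∧ IsMinOf Ap mp ∧ Em = (mq + mp) / 2 ∧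
          (E₀ : ℂ) = 1 / 2 - dz (dzbar ϖ) 0 ∧ (Em : ℂ) = -dz (dzbar ϖ) 0 ∧
          E₀ - Em = 1 / 2) := by
  have hnorm := isQuantization_norm_sq hM hϖ
  have hq := isQuantization_qOf_sq hM hϖ
  have hp := isQuantization_pOf_sq hM hϖ
  refine ⟨hnorm, hq, hp, fun h0 hz hzbar hs ht H Aq Ap hH hAq hAp => ?_⟩
  rw [hH.unique hnorm, hAq.unique hq, hAp.unique hp]
  simpa [h0, hz, hzbar] using exists_energies hs ht

theorem mainTheorem4 (ϖ : ℂ → ℂ)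
    (M : Hilb →L[ℂ] Hilb)
    (hM : IsWeightOperator ϖ M)
    (hϖ : ContDiffAt ℝ 2 ϖ 0) :
    -- the general weight
    IsQuantization M (fun z => (‖z‖ ^ 2 : ℝ))
      (ϖ 0 • (opAdag * opA)
        + dz ϖ 0 • opA
        - dzbar ϖ 0 • opAdag
        + (ϖ 0 / 2 - dz (dzbar ϖ) 0) • 1) ∧
    -- regular weights
    (IsRegularWeight ϖ →
      IsQuantization M (fun z => (‖z‖ ^ 2 : ℝ))
        (opAdag * opA
          + (1 / 2 - dz (dzbar ϖ) 0) • 1) ∧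
      IsQuantization M (fun z => (qOf z ^ 2 : ℝ))
        (opQ ^ 2
          + (-dz (dzbar ϖ) 0
              + 1 / 2 * (dz (dz ϖ) 0
                + dzbar (dzbar ϖ) 0)) • 1) ∧
      IsQuantization M (fun z => (pOf z ^ 2 : ℝ))
        (opP ^ 2
          + (-dz (dzbar ϖ) 0
              - 1 / 2 * (dz (dz ϖ) 0
                + dzbar (dzbar ϖ) 0)) • 1) ∧
      -- the ground state energy and the minimum of the quantum potential energy; these operators
      -- are the only ones on the Schwartz space that represent the three quantizations
      ∀ H Aq Ap : Module.End ℂ (SchwartzMap ℝ ℂ),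
        IsQuantization M (fun z => (‖z‖ ^ 2 : ℝ)) H →
        IsQuantization M
          (fun z => (qOf z ^ 2 : ℝ)) Aq →
        IsQuantization M
          (fun z => (pOf z ^ 2 : ℝ)) Ap →
        ∃ E₀ mq mp Em : ℝ,
          IsGroundStateEnergy H E₀ ∧
          IsMinOf Aq mq ∧
          IsMinOf Ap mp ∧
          Em = (mq + mp) / 2 ∧
          (E₀ : ℂ) = 1 / 2 - dz (dzbar ϖ) 0 ∧
          (Em : ℂ) = -dz (dzbar ϖ) 0 ∧
          E₀ - Em = 1 / 2) := by
  obtain ⟨hnorm, hq, hp, henergy⟩ := mainTheorem4_general hM hϖ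
  refine ⟨hnorm, fun hr => ⟨?_, ?_, ?_, henergy hr.map_zero hr.dz_zero hr.dzbar_zero
    (hr.dz_dzbar_im hϖ) (hr.dz_dz_add_dzbar_dzbar_im hϖ)⟩⟩
  · simpa [hr.map_zero, hr.dz_zero, hr.dzbar_zero] using hnorm
  · simpa [hr.map_zero, hr.dz_zero, hr.dzbar_zero] using hq
  · simpa [hr.map_zero, hr.dz_zero, hr.dzbar_zero] using hp
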